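/- Let $n\ge 0$, let $Sp(n)$ be the group of quaternionic $n\times n$ matrices $g$ with $gg^*=g^*g=I_n$, acting by conjugation $g.X=gXg^*$ on the real vector space $\mathcal H_n=\{X\in \mathrm{Mat}^{n\times n}(\mathbb H): X=X^*,\ \mathrm{Trace}(X)=0\}$ with the inner product $\langle X,Y\rangle=\mathrm{Re}(\mathrm{Trace}(XY))$. Let $r_1<\dots<r_n$ and $a_1<\dots<a_n$ be real numbers with $\sum_\nu r_\nu=\sum_\nu a_\nu=0$, put $A=\mathrm{Diag}(a_1,\dots,a_n)$, and realize the flag manifold as the orbit $Fl_n(\mathbb H)=Sp(n).\mathrm{Diag}(r_1,\dots,r_n)\subset\mathcal H_n$, where $X$ corresponds to the flag $(L_1,\dots,L_n)$ of orthogonal lines $L_\nu=\{h\in\mathbb H^n: hX^*=r_\nu h\}$. Let $h_A(X)=\langle A,X\rangle$. For $w\in S_n$ write again $w$ for the point $\mathrm{Diag}(r_{w(1)},\dots,r_{w(n)})$; thus $ws_{pq}$, with $s_{pq}$ the transposition of $p$ and $q$, is the point obtained from $w$ by exchanging the diagonal entries in positions $p$ and $q$. For $p<q$ let $K_{pq}\subset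 Sp(n)$ be the subgroup of matrices whose entries vanish except on the diagonal and in the positions $pq$ and $qp$, and let $\mathcal S_{w,pq}:=K_{pq}.w$. Then $Fl_n(\mathbb H)$ is an embedded smooth submanifold of $\mathcal H_n$ of dimension $2n(n-1)$, and: (i) The map $w\mapsto \mathrm{Diag}(r_{w(1)},\dots,r_{w(n)})$ is a bijection from $S_n$ onto the critical set of $h_A:Fl_n(\mathbb H)\to\mathbb R$; the flag of the point $w$ is given by $L_{w(i)}=\mathbb H e_i$, $1\le i\le n$. All critical points are non-degenerate. (ii) Let $w\in S_n$ and $p<q$ with $h_A(w)>h_A(ws_{pq})$. Then $\mathcal S_{w,pq}$ is a metric sphere of dimension four in $(\mathcal H_n,\langle\ ,\ \rangle)$: there are $c\in\mathcal H_n$, a $5$-dimensional linear subspace $E\subset\mathcal H_n$ and $R>0$ with $\mathcal S_{w,pq}=\{X: X-c\in E,\ \|X-c\|=R\}$. The points $w$ and $ws_{pq}$ are antipodal on it, and are its north and south pole, that is, the unique highest and the unique lowest point of $\mathcal S_{w,pq}$ with respect to $h_A$. Each meridian (open half great circle from $w$ to $ws_{pq}$) is a gradient line of $h_A:Fl_n(\mathbb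 H)\to\mathbb R$ with respect to the submanifold metric induced by $\langle\ ,\ \rangle$: it is the trajectory of a solution $\gamma:\mathbb R\to Fl_n(\mathbb H)$ of $\gamma'=\nabla h_A(\gamma)$ with $\gamma(t)\to ws_{pq}$ as $t\to-\infty$ and $\gamma(t)\to w$ as $t\to+\infty$. (iii) For every $w\in S_n$, the negative space of the Hessian of $h_A$ at $w$ (the sum of its eigenspaces, with respect to $\langle\ ,\ \rangle$ on $T_wFl_n(\mathbb H)$, for negative eigenvalues) is the direct sum $\bigoplus_{(p,q)\in\mathcal I}T_w\mathcal S_{w,pq}$, where $\mathcal I$ is the set of all pairs $(p,q)$ with $1\le p<q\le n$ and $h_A(w)>h_A(ws_{pq})$. -/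

import Mathlib

open scoped Quaternion ContDiff Topology

noncomputable section

/-! ### Differential geometry of subsets of a real inner product space -/

namespace SubmanifoldGeom

variable {V : Type*} [NormedAddCommGroup V] [InnerProductSpace ℝ V]

/-- `φ`, restricted to the open neighbourhood `U` of `0` in `ℝ^d`, is a smooth local
parametrization of `M` centred at `x`: a smooth immersion with `φ 0 = x` which is a homeomorphism
of `U` onto a relatively open subset of `M`. -/
structure IsLocalParam (M : Set V) (x : V) {d : ℕ} (φ : EuclideanSpace ℝ (Fin d) → V)
    (U : Set (EuclideanSpace ℝ (Fin d))) : Prop where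
  isOpen : IsOpen U
  zero_mem : 0 ∈ U
  map_zero : φ 0 = x
  smooth : ContDiffOn ℝ ∞ φ U
  immersive : ∀ u ∈ U, Function.Injective (fderiv ℝ φ u)
  homeo : ∃ W : Set V, IsOpen W ∧ φ '' U = M ∩ W ∧
    ∃ ψ : V → EuclideanSpace ℝ (Fin d), Set.LeftInvOn ψ φ U ∧ ContinuousOn ψ (M ∩ W)

/-- `M` is an embedded smooth submanifold of `V` of dimension `d`. -/
def IsSmoothSubmanifold (d : ℕ) (M : Set V) : Prop :=
  ∀ x ∈ M, ∃ (φ : EuclideanSpace ℝ (Fin d) → V) (U : Set (EuclideanSpace ℝ (Fin d))),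
    IsLocalParam M x φ U

/-- `γ` is, on a small interval around `0`, a smooth curve in `M` with `γ 0 = x`. -/
def IsCurveAt (M : Set V) (x : V) (γ : ℝ → V) : Prop :=
  γ 0 = x ∧ ∃ ε > (0 : ℝ), ContDiffOn ℝ ∞ γ (Set.Ioo (-ε) ε) ∧ ∀ t ∈ Set.Ioo (-ε) ε, γ t ∈ M

/-- The tangent space `T_x M`, as a linear subspace of `V`: velocities at `x` of smooth curves
in `M`. (For a submanifold the velocities already form a linear subspace, so that taking the span
adds nothing.) -/
def tangentSpaceOf (M : Set V) (x : V) : Submodule ℝ V :=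
  Submodule.span ℝ {v | ∃ γ : ℝ → V, IsCurveAt M x γ ∧ deriv γ 0 = v}

/-- The critical set of the function `f` on `M`: the differential of `f|_M` vanishes. -/
def critSet (M : Set V) (f : V → ℝ) : Set V :=
  {x | x ∈ M ∧ ∀ γ : ℝ → V, IsCurveAt M x γ → HasDerivAt (fun t => f (γ t)) 0 0}

/-- `g` is the gradient at `x` of `f|_M` with respect to the submanifold metric on `M`. -/
def IsGradientAt (M : Set V) (f : V → ℝ) (x g : V) : Prop :=
  g ∈ tangentSpaceOf M x ∧
    ∀ γ : ℝ → V, IsCurveAt M x γ → HasDerivAt (fun t => f (γ t)) (inner ℝ g (deriv γ 0)) 0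

/-- `C` is (the trace of) a gradient line of `f|_M` running from `y` to `x`: it is the trajectory
of a solution `γ : ℝ → M` of `γ' = ∇(f|_M)(γ)` which tends to `y` at `-∞` and to `x` at `+∞`. -/
def IsGradientLine (M : Set V) (f : V → ℝ) (C : Set V) (y x : V) : Prop :=
  ∃ γ : ℝ → V, Set.range γ = C ∧ C ⊆ M ∧
    (∀ t, ∃ g, IsGradientAt M f (γ t) g ∧ HasDerivAt γ g t) ∧
    Filter.Tendsto γ Filter.atBot (𝓝 y) ∧ Filter.Tendsto γ Filter.atTop (𝓝 x)

/-- `B` is the Hessian of `f|_M` at the critical point `x`: the bilinear form on `T_x M` which in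
each local parametrization is given by the second partial derivatives of `f`. -/
def IsHessianAt (M : Set V) (f : V → ℝ) (x : V)
    (B : LinearMap.BilinForm ℝ (tangentSpaceOf M x)) : Prop :=
  ∀ (d : ℕ) (φ : EuclideanSpace ℝ (Fin d) → V) (U : Set (EuclideanSpace ℝ (Fin d))),
    IsLocalParam M x φ U → ∀ (u v : EuclideanSpace ℝ (Fin d)) (a b : tangentSpaceOf M x),
      (a : V) = fderiv ℝ φ 0 u → (b : V) = fderiv ℝ φ 0 v →
        B a b = iteratedFDeriv ℝ 2 (fun z => f (φ z)) 0 ![u, v]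

/-- The eigenspace, for the real number `μ`, of a bilinear form on a subspace `T` of `V`, with
respect to the inner product. -/
def formEigenspace {T : Submodule ℝ V} (B : LinearMap.BilinForm ℝ T) (μ : ℝ) :
    Submodule ℝ T where
  carrier := {a | ∀ b : T, B a b = μ * inner ℝ a b}
  add_mem' := by
    intro a b ha hb c
    simp only [map_add, LinearMap.add_apply, inner_add_left, mul_add]
    rw [ha c, hb c]
  zero_mem' := by
    intro b
    simp
  smul_mem' := by
    intro c a ha b
    simp only [map_smul, LinearMap.smul_apply, smul_eq_mul, real_inner_smul_left]
    rw [ha b]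
    ring

/-- The negative space of a symmetric bilinear form on a subspace `T` of `V`: the sum of the
eigenspaces (with respect to the inner product) for the negative eigenvalues. -/
def negativeSpace {T : Submodule ℝ V} (B : LinearMap.BilinForm ℝ T) : Submodule ℝ V :=
  (⨆ μ : Set.Iio (0 : ℝ), formEigenspace B (μ : ℝ)).map T.subtype

/-- The round sphere with centre `c` and radius `R` in the affine subspace `c + E`; its dimension
is `dim E - 1`. -/
def roundSphere (c : V) (E : Submodule ℝ V) (R : ℝ) : Set V :=
  {x | x - c ∈ E ∧ ‖x - c‖ = R}

/-- The open half great circle (meridian) with centre `c` from the pole `N` to its antipode which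
passes through the point `c + u` of the equator. -/
def meridian (c N u : V) : Set V :=
  (fun θ : ℝ => c + Real.cos θ • (N - c) + Real.sin θ • u) '' Set.Ioo 0 Real.pi

end SubmanifoldGeom

/-! ### The quaternionic flag manifold -/

namespace QFlag

/-- The group `Sp(n)`: quaternionic `n × n` matrices `g` with `g g* = g* g = 1`. -/
abbrev Sp (n : ℕ) : Type := unitary (Matrix (Fin n) (Fin n) ℍ[ℝ])

/-- Trace-free quaternionic Hermitian matrices, as a real subspace of all matrices. -/
def qhermSubmodule (n : ℕ) : Submodule ℝ (Matrix (Fin n) (Fin n) ℍ[ℝ]) where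
  carrier := {X | X.conjTranspose = X ∧ X.trace = 0}
  add_mem' := by
    rintro X Y ⟨h1, h2⟩ ⟨h3, h4⟩
    exact ⟨by rw [Matrix.conjTranspose_add, h1, h3], by rw [Matrix.trace_add, h2, h4, add_zero]⟩
  zero_mem' := ⟨Matrix.conjTranspose_zero, Matrix.trace_zero _ _⟩
  smul_mem' := by
    rintro c X ⟨h1, h2⟩
    refine ⟨?_, by rw [Matrix.trace_smul, h2, smul_zero]⟩
    have hc : (c • X).conjTranspose = c • X.conjTranspose := by
      ext1 i j
      exact Quaternion.star_smul c (X j i)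
    rw [hc, h1]

/-- The real vector space of trace-free quaternionic Hermitian matrices. It is a separate type, so
that its norm is the one of the inner product `Re Trace (X Y)` below. -/
def QHerm (n : ℕ) : Type := qhermSubmodule n

variable {n : ℕ}

instance : AddCommGroup (QHerm n) := inferInstanceAs (AddCommGroup (qhermSubmodule n))

instance : Module ℝ (QHerm n) := inferInstanceAs (Module ℝ (qhermSubmodule n))

/-- The underlying matrix. -/
def QHerm.mat (X : QHerm n) : Matrix (Fin n) (Fin n) ℍ[ℝ] := X.1

theorem QHerm.ext_mat {X Y : QHerm n} (h : X.mat = Y.mat) : X = Y := Subtype.ext h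

theorem QHerm.mat_star (X : QHerm n) : X.mat.conjTranspose = X.mat := X.2.1

theorem QHerm.mat_trace (X : QHerm n) : X.mat.trace = 0 := X.2.2

theorem QHerm.mat_add (X Y : QHerm n) : (X + Y).mat = X.mat + Y.mat := rfl

theorem QHerm.mat_smul (c : ℝ) (X : QHerm n) : (c • X).mat = c • X.mat := rfl

theorem re_sum {ι : Type*} (s : Finset ι) (f : ι → ℍ[ℝ]) :
    (∑ i ∈ s, f i).re = ∑ i ∈ s, (f i).re := by
  classical
  induction s using Finset.induction_on with
  | empty => simp
  | insert a s ha ih => rw [Finset.sum_insert ha, Finset.sum_insert ha, Quaternion.re_add, ih]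

theorem quat_re_mul_comm (x y : ℍ[ℝ]) : (x * y).re = (y * x).re := by
  simp only [Quaternion.re_mul]
  ring

theorem re_trace_mul_comm (X Y : Matrix (Fin n) (Fin n) ℍ[ℝ]) :
    (X * Y).trace.re = (Y * X).trace.re := by
  simp only [Matrix.trace, Matrix.diag, Matrix.mul_apply, re_sum]
  rw [Finset.sum_comm]
  exact Finset.sum_congr rfl fun i _ => Finset.sum_congr rfl fun j _ => quat_re_mul_comm _ _

theorem re_trace_mul_star (X : Matrix (Fin n) (Fin n) ℍ[ℝ]) :
    (X * X.conjTranspose).trace.re = ∑ i, ∑ j, Quaternion.normSq (X i j) := by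
  simp only [Matrix.trace, Matrix.diag, Matrix.mul_apply, re_sum, Matrix.conjTranspose_apply,
    Quaternion.self_mul_star, Quaternion.re_coe]

/-- The inner product `⟨X, Y⟩ = Re (Trace (X Y))`. -/
@[reducible] def qhermCore (n : ℕ) : InnerProductSpace.Core ℝ (QHerm n) where
  inner X Y := (X.mat * Y.mat).trace.re
  conj_inner_symm X Y := re_trace_mul_comm _ _
  re_inner_nonneg X := by
    change 0 ≤ (X.mat * X.mat).trace.re
    have h := re_trace_mul_star X.mat
    rw [X.mat_star] at h
    rw [h]
    exact Finset.sum_nonneg fun i _ => Finset.sum_nonneg fun j _ => Quaternion.normSq_nonneg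
  add_left X Y Z := by
    simp only [QHerm.mat_add, Matrix.add_mul, Matrix.trace_add, Quaternion.re_add]
  smul_left X Y c := by
    simp [QHerm.mat_smul, Matrix.trace_smul]
  definite X hX := by
    change (X.mat * X.mat).trace.re = 0 at hX
    have h := re_trace_mul_star X.mat
    rw [X.mat_star] at h
    rw [h] at hX
    apply QHerm.ext_mat
    ext1 i j
    have h1 := (Finset.sum_eq_zero_iff_of_nonneg (fun i _ => Finset.sum_nonneg
      fun j _ => Quaternion.normSq_nonneg)).1 hX i (Finset.mem_univ i)
    have h2 := (Finset.sum_eq_zero_iff_of_nonneg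
      fun j _ => Quaternion.normSq_nonneg).1 h1 j (Finset.mem_univ j)
    exact Quaternion.normSq_eq_zero.1 h2

instance : NormedAddCommGroup (QHerm n) := (qhermCore n).toNormedAddCommGroup

instance : InnerProductSpace ℝ (QHerm n) := InnerProductSpace.ofCore (qhermCore n).toCore

theorem inner_def (X Y : QHerm n) : inner ℝ X Y = (X.mat * Y.mat).trace.re := rfl

/-- A quaternionic matrix which is Hermitian has real trace. -/
theorem trace_eq_re {X : Matrix (Fin n) (Fin n) ℍ[ℝ]} (h : X.conjTranspose = X) :
    X.trace = (X.trace.re : ℍ[ℝ]) := by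
  apply Quaternion.star_eq_self.1
  rw [← Matrix.trace_conjTranspose, h]

/-- `Sp(n)` acts on the trace-free Hermitian matrices by conjugation, `g.X = g X g*`. -/
instance : MulAction (Sp n) (QHerm n) where
  smul g X := ⟨g.1 * X.mat * star g.1, by
    have hh : (g.1 * X.mat * star g.1).conjTranspose = g.1 * X.mat * star g.1 := by
      rw [Matrix.star_eq_conjTranspose, Matrix.conjTranspose_mul, Matrix.conjTranspose_mul,
        Matrix.conjTranspose_conjTranspose, X.mat_star, Matrix.mul_assoc]
    refine ⟨hh, ?_⟩
    rw [trace_eq_re hh, re_trace_mul_comm, ← Matrix.mul_assoc, Unitary.star_mul_self_of_mem g.2,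
      Matrix.one_mul, X.mat_trace]
    simp⟩
  one_smul X := by
    apply QHerm.ext_mat
    change (1 : Matrix (Fin n) (Fin n) ℍ[ℝ]) * X.mat * star 1 = X.mat
    simp
  mul_smul g k X := by
    apply QHerm.ext_mat
    change (g.1 * k.1) * X.mat * star (g.1 * k.1) = g.1 * (k.1 * X.mat * star k.1) * star g.1
    simp only [star_mul, Matrix.mul_assoc]

theorem mat_smul_action (g : Sp n) (X : QHerm n) :
    (g • X).mat = g.1 * X.mat * star g.1 := rfl

/-- The real diagonal matrix `Diag(d_1, …, d_n)`, for real numbers with sum zero. -/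
def diagPoint (d : Fin n → ℝ) (hd : ∑ i, d i = 0) : QHerm n :=
  ⟨Matrix.diagonal fun i => (d i : ℍ[ℝ]), by
    refine ⟨?_, ?_⟩
    · rw [Matrix.diagonal_conjTranspose]
      congr 1
      ext1 i
      exact Quaternion.star_coe _
    · rw [Matrix.trace_diagonal]
      have := map_sum (algebraMap ℝ ℍ[ℝ]) d Finset.univ
      rw [hd, map_zero] at this
      exact this.symm⟩

/-- The flag manifold `Fl_n(ℍ)`, realized as the orbit `Sp(n).Diag(r_1, …, r_n)`. -/
def flagManifold (r : Fin n → ℝ) (hr : ∑ i, r i = 0) : Set (QHerm n) :=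
  MulAction.orbit (Sp n) (diagPoint r hr)

/-- The line `L_ν` of the flag `(L_1, …, L_n)` which corresponds to the point `X` of the orbit: the
left `ℍ`-submodule of `ℍⁿ` on which `X`, acting by `h ↦ h X*`, is multiplication by `r_ν`. -/
def flagLine (r : Fin n → ℝ) (X : QHerm n) (ν : Fin n) : Submodule ℍ[ℝ] (Fin n → ℍ[ℝ]) where
  carrier := {h | Matrix.vecMul h X.mat.conjTranspose = fun i => (r ν : ℍ[ℝ]) * h i}
  add_mem' := by
    intro h k hh hk
    simp only [Set.mem_ofPred_eq] at hh hk ⊢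
    rw [Matrix.add_vecMul, hh, hk]
    ext1 i
    simp [mul_add]
  zero_mem' := by
    simp only [Set.mem_ofPred_eq, Matrix.zero_vecMul]
    ext1 i
    simp
  smul_mem' := by
    intro c h hh
    simp only [Set.mem_ofPred_eq] at hh ⊢
    rw [Matrix.smul_vecMul, hh]
    ext1 i
    simp only [Pi.smul_apply, smul_eq_mul, ← mul_assoc]
    rw [(Quaternion.coe_commutes (r ν) c)]

/-- The point of the flag manifold given by a permutation `w`: `Diag(r_{w(1)}, …, r_{w(n)})`. -/
def permPoint (r : Fin n → ℝ) (hr : ∑ i, r i = 0) (w : Equiv.Perm (Fin n)) : QHerm n :=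
  diagPoint (fun i => r (w i)) ((Equiv.sum_comp w r).trans hr)

/-- The height function `h_A(X) = ⟨A, X⟩` with `A = Diag(a_1, …, a_n)`. -/
def height (a : Fin n → ℝ) (ha : ∑ i, a i = 0) (X : QHerm n) : ℝ :=
  inner ℝ (diagPoint a ha) X

/-- The subgroup `K_{pq}` of `Sp(n)`: all entries vanish, except for those on the diagonal and in
the positions `pq` and `qp`. -/
def Kpq (p q : Fin n) : Subgroup (Sp n) where
  carrier := {g | ∀ i j, i ≠ j → ¬(i = p ∧ j = q) → ¬(i = q ∧ j = p) → g.1 i j = 0}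
  one_mem' := by
    intro i j hij _ _
    exact Matrix.one_apply_ne hij
  mul_mem' := by
    intro g k hg hk i j hij h1 h2
    change (g.1 * k.1) i j = 0
    rw [Matrix.mul_apply]
    refine Finset.sum_eq_zero fun l _ => ?_
    by_cases hgz : g.1 i l = 0
    · rw [hgz, zero_mul]
    by_cases hkz : k.1 l j = 0
    · rw [hkz, mul_zero]
    exfalso
    have hA := mt (hg i l)
    have hB := mt (hk l j)
    grind
  inv_mem' := by
    intro g hg i j hij h1 h2
    change star g.1 i j = 0
    rw [Matrix.star_apply, hg j i hij.symm (by tauto) (by tauto), star_zero]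

/-- The orbit `S_{w,pq} = K_{pq}.w`. -/
def orbitSphere (r : Fin n → ℝ) (hr : ∑ i, r i = 0) (w : Equiv.Perm (Fin n)) (p q : Fin n) :
    Set (QHerm n) :=
  MulAction.orbit (Kpq p q) (permPoint r hr w)

/-- The set of pairs `p < q` with `h_A(w) > h_A(w s_{pq})`. -/
def descentPairs (r : Fin n → ℝ) (hr : ∑ i, r i = 0) (a : Fin n → ℝ) (ha : ∑ i, a i = 0)
    (w : Equiv.Perm (Fin n)) : Set (Fin n × Fin n) :=
  {i | i.1 < i.2 ∧
    height a ha (permPoint r hr w) > height a ha (permPoint r hr (w * Equiv.swap i.1 i.2))}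

end QFlag

end

open SubmanifoldGeom QFlag

/-! Every statement is reduced to a diagonal point `D = Diag(d)` with distinct entries `d = r ∘ w`,
since all points `w` lie in one orbit (`flagManifold_eq_orbit`).

Local structure. For an off-diagonal Hermitian `Y` there is a skew `S` with `[S, D] = Y`, so `Y ↦
exp(S) D exp(-S)` parametrizes the orbit near `D` with derivative the identity. The off-diagonal
entries are coordinates there (`injOn_offDiagL_orbit`): the orbit satisfies `P(X) = 0` with `P = ∏
(x - d_j)`, and `P'(d_i) ≠ 0` lets this equation control the diagonal. Hence the tangent space at
`D` is the space of off-diagonal matrices, and the normal vectors at any `X` include everything that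
commutes with `X` (`inner_deriv_eq_zero_of_commute`).

Critical points. At a critical `X` the tangent vector `[S, X]` with `S = [X, A]` has derivative
`-‖S‖²`. So `X` commutes with `A`, is diagonal, and carries the entries `r_j` in some order.

Hessian. For unitary `g`, `h_A(g D g*) = ∑ a_i d_i + ∑ a_i (d_j - d_i) |g_ij|²` (`height_lift`). The
terms that occur are squares of functions vanishing at `g = 1`, so first derivatives of `g` suffice.
The Hessian is diagonal in the matrix entries, with eigenvalue `(a_p - a_q)/(d_q - d_p)` on the pair
`pq`; its sign is opposite to that of `h_A(w) - h_A(w s_pq) = (a_p - a_q)(d_p - d_q)`.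

Spheres. Write `D = c + N`, where `c` has equal entries at `p, q` and `N` is supported in the `pq`
block. Then `K_pq` fixes `c` and acts on the five-dimensional space of trace-free Hermitian blocks
by isometries, transitively on the sphere through `N` (a Hopf map). Along a meridian, `A` minus the
velocity of the `tanh`/`sech` parametrization commutes with the point, hence is normal, so the
velocity is the gradient. -/

noncomputable section

namespace SubmanifoldGeom

/-! ### Charts from a smooth parametrization and a linear coordinate map -/

/-- An injective linear map on a finite-dimensional space is antilipschitz, and strict
differentiability makes it dominate all differences near `x`. Surjectivity of `f'` is not needed,
which matters because the map used later has extra components. -/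
theorem _root_.HasStrictFDerivAt.eventually_eq_imp_eq {E F : Type*} [NormedAddCommGroup E]
    [NormedSpace ℝ E] [FiniteDimensional ℝ E] [NormedAddCommGroup F] [NormedSpace ℝ F]
    {f : E → F} {f' : E →L[ℝ] F} {x : E} (hf : HasStrictFDerivAt f f' x)
    (hinj : Function.Injective f') :
    ∃ W : Set E, IsOpen W ∧ x ∈ W ∧ Set.InjOn f W := by
  obtain ⟨K, hK, hanti⟩ := f'.toLinearMap.exists_antilipschitzWith (LinearMap.ker_eq_bot.2 hinj)
  -- With error constant `1/(2K)`, equal values give `‖y - z‖ ≤ ‖y - z‖ / 2`.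
  have hc : (0 : ℝ) < (2 * (K : ℝ))⁻¹ := by positivity
  have h := hf.isLittleO.def hc
  rw [nhds_prod_eq] at h
  obtain ⟨t, ht, hxt⟩ := (Filter.eventually_prod_self_iff
    (r := fun y z => ‖f y - f z - f' (y - z)‖ ≤ (2 * (K : ℝ))⁻¹ * ‖y - z‖)).1 h
  obtain ⟨W, hWt, hW, hxW⟩ := mem_nhds_iff.1 ht
  refine ⟨W, hW, hxW, fun y hy z hz hyz => ?_⟩
  have h1 := hxt y (hWt hy) z (hWt hz)
  simp only [hyz, sub_self, zero_sub, norm_neg] at h1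
  have h2 := hanti.le_mul_dist y z
  rw [dist_eq_norm, dist_eq_norm] at h2
  change ‖y - z‖ ≤ K * ‖f' y - f' z‖ at h2
  rw [← map_sub] at h2
  have hKr : (0 : ℝ) < K := by exact_mod_cast hK
  have h3 : ‖y - z‖ ≤ 2⁻¹ * ‖y - z‖ := by
    calc ‖y - z‖ ≤ K * ‖f' (y - z)‖ := h2
      _ ≤ K * ((2 * (K : ℝ))⁻¹ * ‖y - z‖) := by gcongr
      _ = 2⁻¹ * ‖y - z‖ := by field_simp
  have h4 : ‖y - z‖ ≤ 0 := by linarith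
  exact sub_eq_zero.1 (norm_le_zero_iff.1 h4)

variable {V : Type*} [NormedAddCommGroup V] [InnerProductSpace ℝ V]

/-- The inverse function theorem inverts `p ∘ θ` near `0`, and injectivity of `p` on `M` near `x`
shows that `θ` misses no nearby point of `M`. The map `ψ` is smooth on the ambient space at `x`, so
composing it with a smooth map into `M` lifts that map smoothly to the parameters. -/
theorem exists_chart {T : Type*} [NormedAddCommGroup T] [NormedSpace ℝ T]
    [FiniteDimensional ℝ T] {M : Set V} {x : V} {θ : T → V} {p : V →L[ℝ] T}
    (hθ : ContDiff ℝ ∞ θ) (hθ0 : θ 0 = x) (hθM : ∀ y, θ y ∈ M)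
    (hp : ∀ v, p (fderiv ℝ θ 0 v) = v)
    (hinj : ∃ W : Set V, IsOpen W ∧ x ∈ W ∧ Set.InjOn p (M ∩ W)) :
    (∃ (φ : EuclideanSpace ℝ (Fin (Module.finrank ℝ T)) → V)
      (U : Set (EuclideanSpace ℝ (Fin (Module.finrank ℝ T)))), IsLocalParam M x φ U) ∧
    ∃ ψ : V → T, ContDiffAt ℝ ∞ ψ x ∧ ψ x = 0 ∧ ∀ᶠ y in 𝓝 x, y ∈ M → θ (ψ y) = y := by
  obtain ⟨W, hW, hxW, hWinj⟩ := hinj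
  have hd : Differentiable ℝ θ := hθ.differentiable (by simp)
  set Φ : T → T := fun y => p (θ y) with hΦ
  have hΦs : ContDiff ℝ ∞ Φ := p.contDiff.comp hθ
  have hΦd : ∀ y, HasFDerivAt Φ (p.comp (fderiv ℝ θ y)) y := fun y =>
    p.hasFDerivAt.comp y (hd y).hasFDerivAt
  have hΦ0' : p.comp (fderiv ℝ θ 0) = (ContinuousLinearEquiv.refl ℝ T : T →L[ℝ] T) := by
    ext v
    exact hp v
  have hΦ0 : HasFDerivAt Φ ((ContinuousLinearEquiv.refl ℝ T : T ≃L[ℝ] T) : T →L[ℝ] T) 0 :=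
    hΦ0' ▸ hΦd 0
  have hstr : HasStrictFDerivAt Φ ((ContinuousLinearEquiv.refl ℝ T : T ≃L[ℝ] T) : T →L[ℝ] T) 0 :=
    hΦs.contDiffAt.hasStrictFDerivAt' hΦ0 (by simp)
  set e := hstr.toOpenPartialHomeomorph Φ with he
  have heΦ : ∀ y, e y = Φ y := fun y => rfl
  have h0s : (0 : T) ∈ e.source := hstr.mem_toOpenPartialHomeomorph_source
  have hpx : p x = Φ 0 := by rw [hΦ]; simp only [hθ0]
  have hsymm : e.symm (p x) = 0 := by rw [hpx, ← heΦ, e.left_inv h0s]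
  have hψs : ContDiffAt ℝ ∞ e.symm (p x) := by
    refine e.contDiffAt_symm (f₀' := ContinuousLinearEquiv.refl ℝ T) ?_ ?_ ?_
    · rw [hpx, ← heΦ]
      exact e.map_source h0s
    · rw [hsymm]
      exact hΦ0
    · rw [hsymm]
      exact hΦs.contDiffAt
  -- Invertibility of `p ∘ Dθ` is an open condition which holds at `0`, and it forces `Dθ` to be
  -- injective.
  have hinv : {y : T | Function.Injective (fderiv ℝ θ y)} ∈ 𝓝 (0 : T) := by
    have hcont : Continuous fun y => p.comp (fderiv ℝ θ y) :=
      continuous_const.clm_comp (hθ.continuous_fderiv (by simp))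
    have hnear := hcont.continuousAt.preimage_mem_nhds (x := (0 : T))
      (by rw [hΦ0']; exact (ContinuousLinearEquiv.refl ℝ T).nhds)
    filter_upwards [hnear] with y hy
    obtain ⟨L, hL⟩ := hy
    have : Function.Injective (p.comp (fderiv ℝ θ y)) := by
      have hL' : (L : T →L[ℝ] T) = p.comp (fderiv ℝ θ y) := hL
      rw [← hL']
      exact L.injective
    exact Function.Injective.of_comp (f := p) this
  obtain ⟨U₁, hU₁, hU₁o, h0U₁⟩ := mem_nhds_iff.1 hinv
  set U₀ : Set T := e.source ∩ (U₁ ∩ θ ⁻¹' W) with hU₀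
  have hU₀o : IsOpen U₀ := e.open_source.inter (hU₁o.inter (hW.preimage hd.continuous))
  have h0U₀ : (0 : T) ∈ U₀ := ⟨h0s, h0U₁, by simpa [hθ0] using hxW⟩
  have himg : IsOpen (Φ '' U₀) := e.isOpen_image_of_subset_source hU₀o Set.inter_subset_left
  -- Intersecting with the preimage of `Φ '' U₀` gives each point of `M ∩ W'` a parameter in `U₀`
  -- with the same `p`-value; injectivity of `p` then identifies the two points.
  set W' : Set V := W ∩ p ⁻¹' (Φ '' U₀) with hW'
  have hW'o : IsOpen W' := hW.inter (himg.preimage p.continuous)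
  have hxW' : x ∈ W' := ⟨hxW, 0, h0U₀, hpx.symm⟩
  have key : ∀ y ∈ M ∩ W', e.symm (p y) ∈ U₀ ∧ θ (e.symm (p y)) = y := by
    rintro y ⟨hyM, hyW, u, hu, hpu⟩
    have h1 : e.symm (p y) = u := by rw [← hpu, ← heΦ, e.left_inv hu.1]
    rw [h1]
    exact ⟨hu, hWinj ⟨hθM u, hu.2.2⟩ ⟨hyM, hyW⟩ hpu⟩
  have himage : θ '' U₀ = M ∩ W' := by
    apply Set.Subset.antisymm
    · rintro _ ⟨u, hu, rfl⟩
      exact ⟨hθM u, hu.2.2, u, hu, rfl⟩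
    · intro y hy
      exact ⟨_, key y hy⟩
  refine ⟨?_, fun y => e.symm (p y), ContDiffAt.comp x hψs p.contDiff.contDiffAt, hsymm, ?_⟩
  · let ε : EuclideanSpace ℝ (Fin (Module.finrank ℝ T)) ≃L[ℝ] T :=
      ContinuousLinearEquiv.ofFinrankEq (by simp)
    refine ⟨fun u => θ (ε u), ε ⁻¹' U₀, ⟨hU₀o.preimage ε.continuous, ?_, ?_, ?_, ?_, W', hW'o,
      ?_, fun y => ε.symm (e.symm (p y)), ?_, ?_⟩⟩
    · simpa using h0U₀
    · simpa using hθ0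
    · exact (hθ.comp ε.contDiff).contDiffOn
    · intro u hu
      have h1 : HasFDerivAt (fun u => θ (ε u)) ((fderiv ℝ θ (ε u)).comp (ε : _ →L[ℝ] T)) u :=
        (hd (ε u)).hasFDerivAt.comp u ε.hasFDerivAt
      rw [h1.fderiv]
      exact (hU₁ hu.2.1).comp ε.injective
    · rw [← himage, ← Set.image_image θ ε, Set.image_preimage_eq _ ε.surjective]
    · intro u hu
      change ε.symm (e.symm (Φ (ε u))) = u
      rw [← heΦ, e.left_inv hu.1, ε.symm_apply_apply]
    · refine ε.symm.continuous.comp_continuousOn (e.symm.continuousOn.comp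
        p.continuous.continuousOn ?_)
      rintro y ⟨-, -, u, hu, hpu⟩
      rw [← hpu]
      exact e.map_source hu.1
  · filter_upwards [hW'o.mem_nhds hxW'] with y hy hyM
    exact (key y ⟨hyM, hy⟩).2

/-- Local parametrizations are transported by linear automorphisms preserving the set. -/
theorem IsLocalParam.map {M : Set V} {x : V} {d : ℕ} {φ : EuclideanSpace ℝ (Fin d) → V}
    {U : Set (EuclideanSpace ℝ (Fin d))} (h : IsLocalParam M x φ U) {L L' : V →L[ℝ] V}
    (hL : ∀ v, L (L' v) = v) (hL' : ∀ v, L' (L v) = v) (hM : ∀ v, L v ∈ M ↔ v ∈ M) :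
    IsLocalParam M (L x) (fun u => L (φ u)) U := by
  obtain ⟨W, hW, himg, ψ, hψ, hψc⟩ := h.homeo
  have hM' : ∀ v, L' v ∈ M ↔ v ∈ M := fun v => by rw [← hM, hL]
  refine ⟨h.isOpen, h.zero_mem, by rw [h.map_zero], L.contDiff.comp_contDiffOn h.smooth, ?_,
    L' ⁻¹' W, hW.preimage L'.continuous, ?_, fun v => ψ (L' v), ?_, ?_⟩
  · intro u hu
    have h1 : HasFDerivAt (fun u => L (φ u)) (L.comp (fderiv ℝ φ u)) u :=
      L.hasFDerivAt.comp u
        ((h.smooth.contDiffAt (h.isOpen.mem_nhds hu)).differentiableAt (by simp)).hasFDerivAt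
    rw [h1.fderiv]
    exact (Function.LeftInverse.injective hL').comp (h.immersive u hu)
  · rw [← Set.image_image L φ, himg]
    ext v
    constructor
    · rintro ⟨y, ⟨hyM, hyW⟩, rfl⟩
      exact ⟨(hM y).2 hyM, by simpa [hL'] using hyW⟩
    · rintro ⟨hvM, hvW⟩
      exact ⟨L' v, ⟨(hM' v).2 hvM, hvW⟩, hL v⟩
  · intro u hu
    simp only [hL']
    exact hψ hu
  · refine hψc.comp L'.continuous.continuousOn ?_
    rintro v ⟨hvM, hvW⟩
    exact ⟨(hM' v).2 hvM, hvW⟩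

end SubmanifoldGeom
end

noncomputable section

attribute [local instance] Matrix.linftyOpNormedRing Matrix.linftyOpNormedAlgebra

namespace QFlag

variable {n : ℕ}

/-! ### Linear algebra of trace-free Hermitian matrices -/

instance : FiniteDimensional ℝ (QHerm n) :=
  inferInstanceAs (FiniteDimensional ℝ (qhermSubmodule n))

/-- The matrix of a trace-free Hermitian matrix, as a continuous linear map. -/
def matL (n : ℕ) : QHerm n →L[ℝ] Matrix (Fin n) (Fin n) ℍ[ℝ] :=
  LinearMap.toContinuousLinearMap
    { toFun := QHerm.mat
      map_add' := fun _ _ => rfl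
      map_smul' := fun _ _ => rfl }

@[simp] theorem matL_apply (X : QHerm n) : matL n X = X.mat := rfl

@[simp] theorem mat_zero : (0 : QHerm n).mat = 0 := map_zero (matL n)

theorem mat_sub (X Y : QHerm n) : (X - Y).mat = X.mat - Y.mat := map_sub (matL n) X Y

/-- Any linear left inverse of the inclusion will do. It turns conjugation by `exp S` into a smooth
map into `QHerm n` defined for all matrices `S`, so that it can be differentiated without
restricting to skew ones. -/
theorem exists_hermProj (n : ℕ) :
    ∃ π : Matrix (Fin n) (Fin n) ℍ[ℝ] →L[ℝ] QHerm n, ∀ X : QHerm n, π X.mat = X := by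
  obtain ⟨g, hg⟩ := (matL n).toLinearMap.exists_leftInverse_of_injective
    (LinearMap.ker_eq_bot.2 fun X Y h => QHerm.ext_mat h)
  exact ⟨LinearMap.toContinuousLinearMap g, fun X => LinearMap.congr_fun hg X⟩

/-- A linear projection of all matrices onto the trace-free Hermitian ones. -/
def hermProj (n : ℕ) : Matrix (Fin n) (Fin n) ℍ[ℝ] →L[ℝ] QHerm n := (exists_hermProj n).choose

@[simp] theorem hermProj_mat (X : QHerm n) : hermProj n X.mat = X :=
  (exists_hermProj n).choose_spec X

/-- A matrix entry, as a continuous linear map. -/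
def entryL (i j : Fin n) : Matrix (Fin n) (Fin n) ℍ[ℝ] →L[ℝ] ℍ[ℝ] :=
  LinearMap.toContinuousLinearMap
    { toFun := fun X => X i j
      map_add' := fun _ _ => rfl
      map_smul' := fun _ _ => rfl }

@[simp] theorem entryL_apply (i j : Fin n) (X : Matrix (Fin n) (Fin n) ℍ[ℝ]) :
    entryL i j X = X i j := rfl

theorem star_mat_apply (X : QHerm n) (i j : Fin n) : star (X.mat i j) = X.mat j i := by
  conv_rhs => rw [← X.mat_star]
  rfl

theorem mat_diag_eq_re (X : QHerm n) (i : Fin n) : X.mat i i = ((X.mat i i).re : ℍ[ℝ]) :=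
  Quaternion.star_eq_self.1 (star_mat_apply X i i)

theorem inner_eq_sum (X Y : QHerm n) :
    inner ℝ X Y = ∑ i, ∑ j, inner ℝ (X.mat i j) (Y.mat i j) := by
  rw [inner_def]
  simp only [Matrix.trace, Matrix.diag, Matrix.mul_apply, re_sum, Quaternion.inner_def,
    star_mat_apply]

theorem diagPoint_mat (d : Fin n → ℝ) (hd : ∑ i, d i = 0) :
    (diagPoint d hd).mat = Matrix.diagonal fun i => (d i : ℍ[ℝ]) := rfl

theorem inner_diagPoint (d : Fin n → ℝ) (hd : ∑ i, d i = 0) (X : QHerm n) :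
    inner ℝ (diagPoint d hd) X = ∑ i, d i * (X.mat i i).re := by
  rw [inner_def, diagPoint_mat]
  simp [Matrix.trace, re_sum, Matrix.diagonal_mul]

theorem smul_add_action (g : Sp n) (X Y : QHerm n) : g • (X + Y) = g • X + g • Y := by
  apply QHerm.ext_mat
  simp only [mat_smul_action, QHerm.mat_add, mul_add, add_mul]

theorem smul_smul_action (g : Sp n) (c : ℝ) (X : QHerm n) : g • (c • X) = c • (g • X) := by
  apply QHerm.ext_mat
  simp only [mat_smul_action, QHerm.mat_smul, mul_smul_comm, smul_mul_assoc]

/-- The action of an element of `Sp(n)`, as a continuous linear map. -/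
def actL (g : Sp n) : QHerm n →L[ℝ] QHerm n :=
  LinearMap.toContinuousLinearMap
    { toFun := fun X => g • X
      map_add' := smul_add_action g
      map_smul' := smul_smul_action g }

@[simp] theorem actL_apply (g : Sp n) (X : QHerm n) : actL g X = g • X := rfl

theorem inner_smul_smul_action (g : Sp n) (X Y : QHerm n) :
    inner ℝ (g • X) (g • Y) = inner ℝ X Y := by
  have hg : star g.1 * g.1 = 1 := Unitary.star_mul_self_of_mem g.2
  have : g.1 * X.mat * star g.1 * (g.1 * Y.mat * star g.1)
      = g.1 * (X.mat * Y.mat * star g.1) := by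
    calc _ = g.1 * X.mat * (star g.1 * g.1) * Y.mat * star g.1 := by simp only [mul_assoc]
      _ = _ := by rw [hg, mul_one]; simp only [mul_assoc]
  rw [inner_def, inner_def, mat_smul_action, mat_smul_action, this, re_trace_mul_comm,
    mul_assoc, hg, mul_one]

/-- The trace-free Hermitian matrices with vanishing diagonal. -/
def offDiagSub (n : ℕ) : Submodule ℝ (QHerm n) where
  carrier := {X | ∀ i, X.mat i i = 0}
  add_mem' := by
    intro X Y hX hY i
    rw [QHerm.mat_add, Matrix.add_apply, hX, hY, add_zero]
  zero_mem' := by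
    intro i
    simp
  smul_mem' := by
    intro c X hX i
    rw [QHerm.mat_smul, Matrix.smul_apply, hX, smul_zero]

/-- The Hermitian matrix with vanishing diagonal and given entries off the diagonal. -/
def offDiagOf (f : Matrix (Fin n) (Fin n) ℍ[ℝ]) (hf : ∀ i j, i ≠ j → star (f i j) = f j i) :
    offDiagSub n :=
  ⟨⟨Matrix.of fun i j => if i = j then 0 else f i j, by
    refine ⟨?_, ?_⟩
    · ext1 i j
      rw [Matrix.conjTranspose_apply]
      by_cases h : i = j
      · simp [h]
      · simp [h, Ne.symm h, hf j i (Ne.symm h)]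
    · simp [Matrix.trace]⟩, by
    intro i
    change (if i = i then 0 else f i i) = 0
    simp⟩

theorem offDiagOf_mat (f : Matrix (Fin n) (Fin n) ℍ[ℝ]) (hf) (i j : Fin n) :
    (offDiagOf f hf).1.mat i j = if i = j then 0 else f i j := rfl

/-- The part of a matrix off the diagonal. -/
def offDiagL (n : ℕ) : QHerm n →L[ℝ] offDiagSub n :=
  LinearMap.toContinuousLinearMap
    { toFun := fun X => offDiagOf X.mat fun i j _ => star_mat_apply X i j
      map_add' := by
        intro X Y
        apply Subtype.ext
        apply QHerm.ext_mat
        ext1 i j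
        change (if i = j then 0 else X.mat i j + Y.mat i j)
          = (if i = j then 0 else X.mat i j) + (if i = j then 0 else Y.mat i j)
        split_ifs <;> simp
      map_smul' := by
        intro c X
        apply Subtype.ext
        apply QHerm.ext_mat
        ext1 i j
        change (if i = j then 0 else c • X.mat i j) = c • (if i = j then 0 else X.mat i j)
        split_ifs <;> simp }

theorem offDiagL_mat (X : QHerm n) (i j : Fin n) :
    (offDiagL n X).1.mat i j = if i = j then 0 else X.mat i j := rfl

theorem offDiagL_coe (X : offDiagSub n) : offDiagL n X = X := by
  apply Subtype.ext
  apply QHerm.ext_mat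
  ext1 i j
  rw [offDiagL_mat]
  split_ifs with h
  · rw [h, X.2 j]
  · rfl

theorem card_lt_pairs (n : ℕ) :
    Fintype.card {p : Fin n × Fin n // p.1 < p.2} * 2 = n * (n - 1) := by
  rw [Fintype.card_subtype, Finset.card_filter, Fintype.sum_prod_type_right]
  have h : ∀ j : Fin n, (∑ i : Fin n, if i < j then 1 else 0) = (j : ℕ) := by
    intro j
    rw [← Finset.card_filter, ← Fin.card_Iio j]
    congr 1
    ext i
    simp
  rw [Finset.sum_congr rfl fun j _ => h j]
  rw [Fin.sum_univ_eq_sum_range (fun i => i) n, Finset.sum_range_id_mul_two]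

/-- Such a matrix is determined by its strict upper triangle: four real parameters for each of the
`n (n - 1) / 2` pairs. -/
theorem finrank_offDiagSub (n : ℕ) : Module.finrank ℝ (offDiagSub n) = 2 * n * (n - 1) := by
  let e : offDiagSub n ≃ₗ[ℝ] ({p : Fin n × Fin n // p.1 < p.2} → ℍ[ℝ]) :=
    { toFun := fun X p => X.1.mat p.1.1 p.1.2
      map_add' := fun _ _ => rfl
      map_smul' := fun _ _ => rfl
      invFun := fun f => offDiagOf
        (Matrix.of fun i j => if h : i < j then f ⟨(i, j), h⟩ else
          if h : j < i then star (f ⟨(j, i), h⟩) else 0) (by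
          intro i j hij
          simp only [Matrix.of_apply]
          rcases lt_or_gt_of_ne hij with h | h
          · simp [h, h.not_gt]
          · simp [h, h.not_gt])
      left_inv := by
        intro X
        apply Subtype.ext
        apply QHerm.ext_mat
        ext1 i j
        rw [offDiagOf_mat, Matrix.of_apply]
        rcases lt_trichotomy i j with h | h | h
        · simp [h, h.ne]
        · simp [h, X.2 j]
        · simp [h, h.ne', h.not_gt, star_mat_apply]
      right_inv := by
        intro f
        funext p
        change (offDiagOf _ _).1.mat p.1.1 p.1.2 = _
        rw [offDiagOf_mat, Matrix.of_apply]
        simp [p.2, p.2.ne] }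
  rw [e.finrank_eq, Module.finrank_pi_fintype]
  simp only [Quaternion.finrank_eq_four, Finset.sum_const, Finset.card_univ, smul_eq_mul]
  have := card_lt_pairs n
  rw [mul_assoc, ← this]
  ring

end QFlag
end

noncomputable section

attribute [local instance] Matrix.linftyOpNormedRing Matrix.linftyOpNormedAlgebra

namespace QFlag

variable {n : ℕ}

/-! ### Exponential curves in orbits -/

theorem completeSpace_matrix : CompleteSpace (Matrix (Fin n) (Fin n) ℍ[ℝ]) :=
  FiniteDimensional.complete ℝ _

attribute [local instance] completeSpace_matrix

theorem continuousStar_matrix : ContinuousStar (Matrix (Fin n) (Fin n) ℍ[ℝ]) :=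
  ⟨Continuous.matrix_conjTranspose continuous_id⟩

attribute [local instance] continuousStar_matrix

theorem star_smul_matrix (c : ℝ) (S : Matrix (Fin n) (Fin n) ℍ[ℝ]) :
    star (c • S) = c • star S := by
  ext1 i j
  exact Quaternion.star_smul c (S j i)

theorem exp_mem_Sp {S : Matrix (Fin n) (Fin n) ℍ[ℝ]} (hS : star S = -S) :
    NormedSpace.exp S ∈ unitary (Matrix (Fin n) (Fin n) ℍ[ℝ]) := by
  let _ : NormedAlgebra ℚ (Matrix (Fin n) (Fin n) ℍ[ℝ]) := NormedAlgebra.restrictScalars ℚ ℝ _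
  exact @NormedSpace.exp_mem_unitary_of_mem_skewAdjoint _ _ _ _ _ continuousStar_matrix _
    (skewAdjoint.mem_iff.2 hS)

theorem star_exp_of_skew {S : Matrix (Fin n) (Fin n) ℍ[ℝ]} (hS : star S = -S) :
    star (NormedSpace.exp S) = NormedSpace.exp (-S) := by
  let _ : NormedAlgebra ℚ (Matrix (Fin n) (Fin n) ℍ[ℝ]) := NormedAlgebra.restrictScalars ℚ ℝ _
  rw [NormedSpace.star_exp, hS]

theorem contDiff_exp_matrix :
    ContDiff ℝ ∞ (NormedSpace.exp : Matrix (Fin n) (Fin n) ℍ[ℝ] → _) :=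
  contDiff_iff_contDiffAt.2 fun S => (NormedSpace.exp_analytic (𝕂 := ℝ) S).contDiffAt

/-- Conjugation of a trace-free Hermitian matrix by the exponential of `S`. -/
def expConj (X : QHerm n) (S : Matrix (Fin n) (Fin n) ℍ[ℝ]) : QHerm n :=
  hermProj n (NormedSpace.exp S * X.mat * NormedSpace.exp (-S))

theorem expConj_eq_smul (X : QHerm n) {S : Matrix (Fin n) (Fin n) ℍ[ℝ]} (hS : star S = -S) :
    expConj X S = (⟨NormedSpace.exp S, exp_mem_Sp hS⟩ : Sp n) • X := by
  rw [expConj, ← star_exp_of_skew hS]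
  exact hermProj_mat ((⟨NormedSpace.exp S, exp_mem_Sp hS⟩ : Sp n) • X)

theorem expConj_mem_orbit (X : QHerm n) {S : Matrix (Fin n) (Fin n) ℍ[ℝ]} (hS : star S = -S) :
    expConj X S ∈ MulAction.orbit (Sp n) X := by
  rw [expConj_eq_smul X hS]
  exact MulAction.mem_orbit _ _

theorem expConj_zero (X : QHerm n) : expConj X 0 = X := by
  simp [expConj]

theorem contDiff_expConj (X : QHerm n) : ContDiff ℝ ∞ (expConj X) :=
  (hermProj n).contDiff.comp
    ((contDiff_exp_matrix.mul contDiff_const).mul (contDiff_exp_matrix.comp contDiff_neg))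

theorem fderiv_expConj (X : QHerm n) (S : Matrix (Fin n) (Fin n) ℍ[ℝ]) :
    fderiv ℝ (expConj X) 0 S = hermProj n (S * X.mat - X.mat * S) := by
  have h1 : HasFDerivAt (NormedSpace.exp : Matrix (Fin n) (Fin n) ℍ[ℝ] → _)
      (1 : _ →L[ℝ] Matrix (Fin n) (Fin n) ℍ[ℝ]) 0 := hasFDerivAt_exp_zero
  have h1' : HasFDerivAt (NormedSpace.exp : Matrix (Fin n) (Fin n) ℍ[ℝ] → _)
      (1 : _ →L[ℝ] Matrix (Fin n) (Fin n) ℍ[ℝ]) (-0) := by rwa [neg_zero]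
  have h2 := h1'.comp (0 : Matrix (Fin n) (Fin n) ℍ[ℝ]) (hasFDerivAt_id _).neg
  have h3 := (hermProj n).hasFDerivAt.comp _ ((h1.mul_const' X.mat).mul' h2)
  have h4 : HasFDerivAt (expConj X) _ 0 := h3
  rw [h4.fderiv]
  change hermProj n ((NormedSpace.exp 0 * X.mat) * (-S)
    + S * X.mat * NormedSpace.exp (-0 : Matrix (Fin n) (Fin n) ℍ[ℝ])) = _
  simp [sub_eq_neg_add]

/-- The tangent vectors to an orbit given by the infinitesimal action. -/
theorem isCurveAt_expConj (X : QHerm n) {S : Matrix (Fin n) (Fin n) ℍ[ℝ]} (hS : star S = -S) :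
    IsCurveAt (MulAction.orbit (Sp n) X) X (fun t : ℝ => expConj X (t • S)) ∧
      HasDerivAt (fun t : ℝ => expConj X (t • S)) (hermProj n (S * X.mat - X.mat * S)) 0 := by
  have hsm : ContDiff ℝ ∞ fun t : ℝ => expConj X (t • S) :=
    (contDiff_expConj X).comp (contDiff_id.smul contDiff_const)
  refine ⟨⟨by simp [expConj_zero], 1, one_pos, hsm.contDiffOn, fun t _ => ?_⟩, ?_⟩
  · refine expConj_mem_orbit X ?_
    rw [star_smul_matrix, hS, smul_neg]
  · have h1 : HasFDerivAt (expConj X) (fderiv ℝ (expConj X) 0) ((0 : ℝ) • S) := by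
      rw [zero_smul]
      exact ((contDiff_expConj X).differentiable (by simp) 0).hasFDerivAt
    have h2 : HasDerivAt (fun t : ℝ => t • S) S 0 := by
      have h := (hasDerivAt_id (0 : ℝ)).smul_const S
      rw [one_smul] at h
      exact h
    have h3 : fderiv ℝ (expConj X) 0 S = hermProj n (S * X.mat - X.mat * S) := fderiv_expConj X S
    rw [← h3]
    exact HasFDerivAt.comp_hasDerivAt (l := expConj X) (f := fun t : ℝ => t • S) (0 : ℝ) h1 h2

/-! ### The parametrization of the orbit near a diagonal point -/

/-- The skew-Hermitian `S` with `[S, Diag(d)] = Y`. -/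
def skewOf (d : Fin n → ℝ) : offDiagSub n →L[ℝ] Matrix (Fin n) (Fin n) ℍ[ℝ] :=
  LinearMap.toContinuousLinearMap
    { toFun := fun Y => Matrix.of fun i j => (d j - d i)⁻¹ • Y.1.mat i j
      map_add' := by
        intro X Y
        ext1 i j
        exact smul_add (d j - d i)⁻¹ (X.1.mat i j) (Y.1.mat i j)
      map_smul' := by
        intro c X
        ext1 i j
        exact smul_comm (d j - d i)⁻¹ c (X.1.mat i j) }

theorem skewOf_apply (d : Fin n → ℝ) (Y : offDiagSub n) (i j : Fin n) :
    skewOf d Y i j = (d j - d i)⁻¹ • Y.1.mat i j := rfl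

theorem star_skewOf (d : Fin n → ℝ) (Y : offDiagSub n) : star (skewOf d Y) = -skewOf d Y := by
  ext1 i j
  rw [Matrix.star_apply, Matrix.neg_apply, skewOf_apply, skewOf_apply, Quaternion.star_smul,
    star_mat_apply, ← neg_smul, ← inv_neg, neg_sub]

theorem commutator_skewOf {d : Fin n → ℝ} (hdi : Function.Injective d) (hd : ∑ i, d i = 0)
    (Y : offDiagSub n) :
    skewOf d Y * (diagPoint d hd).mat - (diagPoint d hd).mat * skewOf d Y = Y.1.mat := by
  ext1 i j
  rw [Matrix.sub_apply, diagPoint_mat, Matrix.mul_diagonal, Matrix.diagonal_mul, skewOf_apply,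
    ← Quaternion.coe_commutes (d j), Quaternion.coe_mul_eq_smul, Quaternion.coe_mul_eq_smul,
    ← sub_smul, smul_smul]
  -- On the diagonal the factor `(d j - d i)⁻¹` is the default value `0⁻¹ = 0`; this is harmless
  -- because `Y` has zero diagonal.
  by_cases h : i = j
  · rw [h, Y.2 j, smul_zero]
  · have : d j - d i ≠ 0 := sub_ne_zero.2 fun h' => h (hdi h'.symm)
    rw [mul_inv_cancel₀ this, one_smul]

/-- The parametrization `Y ↦ exp(S).Diag(d)`, where `[S, Diag(d)] = Y`. -/
def orbitParam (d : Fin n → ℝ) (hd : ∑ i, d i = 0) (Y : offDiagSub n) : QHerm n :=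
  expConj (diagPoint d hd) (skewOf d Y)

theorem contDiff_orbitParam (d : Fin n → ℝ) (hd : ∑ i, d i = 0) :
    ContDiff ℝ ∞ (orbitParam d hd) :=
  (contDiff_expConj _).comp (skewOf d).contDiff

theorem fderiv_orbitParam {d : Fin n → ℝ} (hdi : Function.Injective d) (hd : ∑ i, d i = 0)
    (Y : offDiagSub n) : fderiv ℝ (orbitParam d hd) 0 Y = Y := by
  have h1 : HasFDerivAt (expConj (diagPoint d hd)) (fderiv ℝ (expConj (diagPoint d hd)) 0)
      (skewOf d (0 : offDiagSub n)) := by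
    rw [map_zero]
    exact ((contDiff_expConj _).differentiable (by simp) 0).hasFDerivAt
  have h2 := h1.comp (0 : offDiagSub n) (skewOf d).hasFDerivAt
  have h3 : HasFDerivAt (orbitParam d hd) _ 0 := h2
  rw [h3.fderiv]
  change fderiv ℝ (expConj (diagPoint d hd)) 0 (skewOf d Y) = Y
  rw [fderiv_expConj, commutator_skewOf hdi, hermProj_mat]

/-! ### The orbit near a diagonal point is determined by the entries off the diagonal -/

open Polynomial in
theorem aeval_diagonal (d : Fin n → ℝ) (P : ℝ[X]) :
    aeval (Matrix.diagonal fun i => (d i : ℍ[ℝ])) P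
      = Matrix.diagonal fun i => ((P.eval (d i) : ℝ) : ℍ[ℝ]) := by
  have h := aeval_algHom_apply (Matrix.diagonalAlgHom (n := Fin n) (α := ℍ[ℝ]) ℝ)
    (fun i => (d i : ℍ[ℝ])) P
  rw [Matrix.diagonalAlgHom_apply, Matrix.diagonalAlgHom_apply] at h
  rw [h]
  congr 1
  funext i
  have h2 := aeval_algHom_apply (Pi.evalAlgHom ℝ (fun _ : Fin n => ℍ[ℝ]) i)
    (fun i => (d i : ℍ[ℝ])) P
  simp only [Pi.evalAlgHom_apply] at h2
  rw [← h2]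
  exact aeval_algebraMap_apply_eq_algebraMap_eval (A := ℍ[ℝ]) (d i) P

-- Quaternionic matrices do not commute, so the derivative of `P` in direction `Y` is not `P'(X) Y`
-- in general. At a diagonal matrix with real entries, however, each term `D^k Y D^l` has diagonal
-- entries `d_i^(k+l) Y_ii`, so on the diagonal the commutative formula survives.
open Polynomial in
theorem exists_hasStrictFDerivAt_aeval (d : Fin n → ℝ) (P : ℝ[X]) :
    ∃ L : Matrix (Fin n) (Fin n) ℍ[ℝ] →L[ℝ] Matrix (Fin n) (Fin n) ℍ[ℝ],
      HasStrictFDerivAt (fun X => aeval X P) L (Matrix.diagonal fun i => (d i : ℍ[ℝ])) ∧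
      ∀ Y i, L Y i i = P.derivative.eval (d i) • Y i i := by
  induction P using Polynomial.induction_on' with
  | add P Q hP hQ =>
    obtain ⟨L, hL, hL'⟩ := hP
    obtain ⟨K, hK, hK'⟩ := hQ
    refine ⟨L + K, ?_, fun Y i => ?_⟩
    · simp only [map_add]
      exact hL.add hK
    simp [hL', hK', add_smul]
  | monomial k c =>
    induction k with
    | zero =>
      exact ⟨0, by simpa using hasStrictFDerivAt_const _ _, by simp⟩
    | succ k ih =>
      obtain ⟨L, hL, hL'⟩ := ih
      have h := hL.mul' (hasStrictFDerivAt_id _)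
      refine ⟨_, h.congr_of_eventuallyEq (Filter.Eventually.of_forall fun X => ?_), fun Y i => ?_⟩
      · change aeval X (monomial k c) * X = aeval X (monomial (k + 1) c)
        rw [← monomial_mul_X, map_mul, aeval_X]
      · change ((aeval (Matrix.diagonal fun i => (d i : ℍ[ℝ]))) (monomial k c) * Y
          + L Y * Matrix.diagonal fun i => (d i : ℍ[ℝ])) i i = _
        rw [aeval_diagonal, Matrix.add_apply, Matrix.mul_diagonal, Matrix.diagonal_mul, hL',
          ← monomial_mul_X, derivative_mul, derivative_X, mul_one, eval_add, eval_mul, eval_X,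
          ← Quaternion.coe_commutes, Quaternion.coe_mul_eq_smul, Quaternion.coe_mul_eq_smul,
          smul_smul, ← add_smul]
        congr 1
        ring

-- All points of the orbit are annihilated by `P = ∏ (x - d_j)`. The map `X ↦ (off-diagonal part of
-- X, diagonal of P(X))` has injective derivative at `Diag(d)`, because `P'(d_i) ≠ 0`; it is
-- therefore injective nearby, and on the orbit its second component is constantly zero.
open Polynomial in
theorem injOn_offDiagL_orbit {d : Fin n → ℝ} (hdi : Function.Injective d) (hd : ∑ i, d i = 0) :
    ∃ W : Set (QHerm n), IsOpen W ∧ diagPoint d hd ∈ W ∧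
      Set.InjOn (offDiagL n) (MulAction.orbit (Sp n) (diagPoint d hd) ∩ W) := by
  set P : ℝ[X] := ∏ j, (X - C (d j)) with hP
  have hP0 : ∀ i, P.eval (d i) = 0 := fun i => by
    rw [hP, eval_prod]
    exact Finset.prod_eq_zero (Finset.mem_univ i) (by simp)
  have hP' : ∀ i, P.derivative.eval (d i) ≠ 0 := by
    intro i
    have hsep : P.Separable := separable_prod_X_sub_C_iff.2 hdi
    intro h0
    obtain ⟨u, v, huv⟩ := hsep
    have := congrArg (eval (d i)) huv
    simp [hP0, h0] at this
  have hPD : aeval (diagPoint d hd).mat P = 0 := by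
    rw [diagPoint_mat, aeval_diagonal]
    simp [hP0]
  -- Polynomial evaluation with real coefficients commutes with conjugation, and `P` kills the base
  -- point.
  have hPM : ∀ X ∈ MulAction.orbit (Sp n) (diagPoint d hd), aeval X.mat P = 0 := by
    rintro _ ⟨g, rfl⟩
    change aeval (g • diagPoint d hd).mat P = 0
    have hg : star g.1 * g.1 = 1 := Unitary.star_mul_self_of_mem g.2
    have hpow : ∀ k : ℕ, (g • diagPoint d hd).mat ^ k
        = g.1 * (diagPoint d hd).mat ^ k * star g.1 := by
      intro k
      induction k with
      | zero => rw [pow_zero, pow_zero, mul_one, Unitary.mul_star_self_of_mem g.2]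
      | succ k ih =>
        rw [pow_succ, ih, mat_smul_action, pow_succ]
        calc _ = g.1 * (diagPoint d hd).mat ^ k * (star g.1 * g.1) * (diagPoint d hd).mat
              * star g.1 := by simp only [mul_assoc]
          _ = _ := by rw [hg, mul_one]; simp only [mul_assoc]
    have : aeval (g • diagPoint d hd).mat P
        = g.1 * aeval (diagPoint d hd).mat P * star g.1 := by
      rw [aeval_eq_sum_range, aeval_eq_sum_range, Finset.mul_sum, Finset.sum_mul]
      refine Finset.sum_congr rfl fun k _ => ?_
      rw [hpow, mul_smul_comm, smul_mul_assoc]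
    rw [this, hPD, mul_zero, zero_mul]
  obtain ⟨L, hL, hL'⟩ := exists_hasStrictFDerivAt_aeval d P
  have h1 : HasStrictFDerivAt (fun X : QHerm n => aeval X.mat P) (L.comp (matL n))
      (diagPoint d hd) :=
    HasStrictFDerivAt.comp (f := matL n) (diagPoint d hd) hL (matL n).hasStrictFDerivAt
  have h2 : HasStrictFDerivAt (fun X : QHerm n => fun i => aeval X.mat P i i)
      (ContinuousLinearMap.pi fun i => (entryL i i).comp (L.comp (matL n))) (diagPoint d hd) :=
    hasStrictFDerivAt_pi.2 fun i =>
      HasStrictFDerivAt.comp (g := entryL i i) (diagPoint d hd) (entryL i i).hasStrictFDerivAt h1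
  have h3 := (offDiagL n).hasStrictFDerivAt.prodMk h2
  obtain ⟨W, hW, hxW, hinj⟩ := h3.eventually_eq_imp_eq (by
    rw [injective_iff_map_eq_zero]
    intro Y hY
    have hY1 : offDiagL n Y = 0 := congrArg Prod.fst hY
    have hY2 : ∀ i, L Y.mat i i = 0 := fun i => congrFun (congrArg Prod.snd hY) i
    apply QHerm.ext_mat
    ext1 i j
    by_cases h : i = j
    · have := hY2 i
      rw [hL', smul_eq_zero] at this
      rw [← h, this.resolve_left (hP' i)]
      simp
    · have := congrArg (fun Z : offDiagSub n => Z.1.mat i j) hY1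
      simp only [offDiagL_mat, if_neg h] at this
      rw [this]
      simp)
  refine ⟨W, hW, hxW, fun X hX Y hY hXY => hinj hX.2 hY.2 ?_⟩
  simp only [hXY, hPM X hX.1, hPM Y hY.1]

theorem exists_orbit_chart {d : Fin n → ℝ} (hdi : Function.Injective d) (hd : ∑ i, d i = 0) :
    (∃ (φ : EuclideanSpace ℝ (Fin (2 * n * (n - 1))) → QHerm n)
      (U : Set (EuclideanSpace ℝ (Fin (2 * n * (n - 1))))),
      IsLocalParam (MulAction.orbit (Sp n) (diagPoint d hd)) (diagPoint d hd) φ U) ∧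
    ∃ ψ : QHerm n → offDiagSub n, ContDiffAt ℝ ∞ ψ (diagPoint d hd) ∧
      ψ (diagPoint d hd) = 0 ∧ ∀ᶠ X in 𝓝 (diagPoint d hd),
        X ∈ MulAction.orbit (Sp n) (diagPoint d hd) → orbitParam d hd (ψ X) = X := by
  rw [← finrank_offDiagSub n]
  refine exists_chart (contDiff_orbitParam d hd) ?_ ?_ (p := offDiagL n) ?_
    (injOn_offDiagL_orbit hdi hd)
  · rw [orbitParam, map_zero, expConj_zero]
  · exact fun Y => expConj_mem_orbit _ (star_skewOf d Y)
  · intro Y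
    rw [fderiv_orbitParam hdi, offDiagL_coe]

end QFlag
end

/-! ### Second derivatives of sums of squares, and basic facts on curves. -/

noncomputable section

attribute [local instance] Matrix.linftyOpNormedRing Matrix.linftyOpNormedAlgebra

namespace SubmanifoldGeom

/-- The second derivative of `‖G‖²` is `2⟨DG u, DG v⟩ + 2⟨G, D²G(u, v)⟩`, and the last term dies
where `G` vanishes, so only first derivatives are needed. Vanishing is asked only where `c p ≠ 0`:
in the application the diagonal entries of `g` equal `1` at the origin, but carry coefficient `0`.
-/
theorem iteratedFDeriv_two_sum_norm_sq {E H ι : Type*} [NormedAddCommGroup E] [NormedSpace ℝ E]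
    [NormedAddCommGroup H] [InnerProductSpace ℝ H] (s : Finset ι) (b : ℝ) (c : ι → ℝ)
    {G : ι → E → H} (hG : ∀ p, ContDiffAt ℝ ∞ (G p) 0) (hG0 : ∀ p, c p ≠ 0 → G p 0 = 0)
    (u v : E) :
    iteratedFDeriv ℝ 2 (fun z => b + ∑ p ∈ s, c p * ‖G p z‖ ^ 2) 0 ![u, v]
      = ∑ p ∈ s, c p * (2 * inner ℝ (fderiv ℝ (G p) 0 u) (fderiv ℝ (G p) 0 v)) := by
  set f : E → ℝ := fun z => b + ∑ p ∈ s, c p * ‖G p z‖ ^ 2 with hf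
  have hfs : ContDiffAt ℝ 2 f 0 := by
    refine contDiffAt_const.add (ContDiffAt.sum fun p _ => contDiffAt_const.mul ?_)
    exact (contDiffAt_infty.1 (hG p) 2).norm_sq ℝ
  have hfd : DifferentiableAt ℝ (fderiv ℝ f) 0 :=
    (hfs.fderiv_right (m := 1) (by norm_num)).differentiableAt (by simp)
  have hdiff : ∀ p, ∀ᶠ z in 𝓝 (0 : E), DifferentiableAt ℝ (G p) z := fun p => by
    have h1 : ContDiffAt ℝ 1 (G p) 0 := (hG p).of_le (by exact_mod_cast le_top)
    filter_upwards [h1.eventually (by simp)] with z hz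
    exact hz.differentiableAt (by simp)
  have hfirst : (fun z => fderiv ℝ f z v) =ᶠ[𝓝 0]
      fun z => ∑ p ∈ s, c p * (2 * inner ℝ (G p z) (fderiv ℝ (G p) z v)) := by
    have hall := (Filter.eventually_all_finset s).2 fun p _ => hdiff p
    filter_upwards [hall] with z hz
    have h1 : HasFDerivAt f (∑ p ∈ s, c p • (2 • (innerSL ℝ (G p z)).comp (fderiv ℝ (G p) z))) z :=
      (HasFDerivAt.fun_sum fun p hp => ((hz p hp).hasFDerivAt.norm_sq).const_mul (c p)).const_add b
    rw [h1.fderiv]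
    simp
  have hsecond : HasFDerivAt (fun z => fderiv ℝ f z v)
      ((fderiv ℝ (fderiv ℝ f) 0).flip v) 0 := by
    have := hfd.hasFDerivAt.clm_apply (hasFDerivAt_const v (0 : E))
    simpa using this
  have hgd : ∀ p, DifferentiableAt ℝ (fun z => fderiv ℝ (G p) z v) 0 := fun p =>
    (((contDiffAt_infty.1 (hG p) 2).fderiv_right (m := 1) (by norm_num)).differentiableAt
      (by simp)).clm_apply (differentiableAt_const v)
  have hthird := HasFDerivAt.fun_sum (u := s) (x := (0 : E)) fun p _ =>
    (((((hG p).differentiableAt (by simp)).hasFDerivAt.inner ℝ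
      (hgd p).hasFDerivAt).const_mul 2).const_mul (c p))
  rw [iteratedFDeriv_two_apply]
  change (fderiv ℝ (fderiv ℝ f) 0 u) v = _
  have h4 : (fderiv ℝ (fderiv ℝ f) 0).flip v = _ :=
    (hsecond.congr_of_eventuallyEq hfirst.symm).unique hthird
  rw [← ContinuousLinearMap.flip_apply, h4, sum_apply]
  refine Finset.sum_congr rfl fun p _ => ?_
  by_cases hc : c p = 0
  · simp [hc]
  · simp [fderivInnerCLM_apply, hG0 p hc]

theorem IsCurveAt.contDiffAt {V : Type*} [NormedAddCommGroup V] [InnerProductSpace ℝ V]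
    {M : Set V} {x : V} {γ : ℝ → V} (h : IsCurveAt M x γ) : ContDiffAt ℝ ∞ γ 0 := by
  obtain ⟨-, ε, hε, hs, -⟩ := h
  exact hs.contDiffAt (Ioo_mem_nhds (by linarith) hε)

theorem IsCurveAt.eventually_mem {V : Type*} [NormedAddCommGroup V] [InnerProductSpace ℝ V]
    {M : Set V} {x : V} {γ : ℝ → V} (h : IsCurveAt M x γ) : ∀ᶠ t in 𝓝 0, γ t ∈ M := by
  obtain ⟨-, ε, hε, -, hM⟩ := h
  filter_upwards [Ioo_mem_nhds (show -ε < 0 by linarith) hε] with t ht using hM t ht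

theorem IsCurveAt.hasDerivAt {V : Type*} [NormedAddCommGroup V] [InnerProductSpace ℝ V]
    {M : Set V} {x : V} {γ : ℝ → V} (h : IsCurveAt M x γ) : HasDerivAt γ (deriv γ 0) 0 :=
  (h.contDiffAt.differentiableAt (by simp)).hasDerivAt

end SubmanifoldGeom

namespace QFlag

variable {n : ℕ}

/-! ### Smooth maps into an orbit near a diagonal point -/

/-- Quaternionic conjugation, as a continuous real linear map. -/
def quatStarL : ℍ[ℝ] →L[ℝ] ℍ[ℝ] :=
  LinearMap.toContinuousLinearMap
    { toFun := star
      map_add' := star_add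
      map_smul' := fun c x => Quaternion.star_smul c x }

section Lift

variable {E : Type*} [NormedAddCommGroup E] [NormedSpace ℝ E]

/-- Applying the chart coordinates `ψ` and then `exp ∘ skewOf d` lifts a smooth map into the orbit
to unitary matrices. Tangent vectors and the Hessian are both computed from such a lift, with curves
and local parametrizations as `F`. -/
theorem exists_unitary_lift {d : Fin n → ℝ} (hdi : Function.Injective d) (hd : ∑ i, d i = 0)
    {F : E → QHerm n} (hF : ContDiffAt ℝ ∞ F 0) (hF0 : F 0 = diagPoint d hd)
    (hFM : ∀ᶠ z in 𝓝 0, F z ∈ MulAction.orbit (Sp n) (diagPoint d hd)) :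
    ∃ G : E → Matrix (Fin n) (Fin n) ℍ[ℝ], (∀ i j, ContDiffAt ℝ ∞ (fun z => G z i j) 0) ∧
      G 0 = 1 ∧ ∀ᶠ z in 𝓝 0, G z * star (G z) = 1 ∧
        (F z).mat = G z * (diagPoint d hd).mat * star (G z) := by
  obtain ⟨-, ψ, hψ, hψ0, hψM⟩ := exists_orbit_chart hdi hd
  refine ⟨fun z => NormedSpace.exp (skewOf d (ψ (F z))), fun i j => ?_, ?_, ?_⟩
  · have h1 : ContDiffAt ℝ ∞ (fun z => ψ (F z)) 0 := by
      rw [← hF0] at hψ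
      exact ContDiffAt.comp (0 : E) hψ hF
    exact (((entryL i j).contDiff.comp contDiff_exp_matrix).comp
      (skewOf d).contDiff).contDiffAt.comp (0 : E) h1
  · simp only [hF0, hψ0, map_zero, NormedSpace.exp_zero]
  · have hc : Filter.Tendsto F (𝓝 0) (𝓝 (diagPoint d hd)) := by
      have := hF.continuousAt.tendsto
      rwa [hF0] at this
    filter_upwards [hFM, hc.eventually hψM] with z hz hz'
    have h1 := hz' hz
    rw [orbitParam, expConj_eq_smul _ (star_skewOf d _)] at h1
    refine ⟨Unitary.mul_star_self_of_mem (exp_mem_Sp (star_skewOf d _)), ?_⟩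
    conv_lhs => rw [← h1]
    rfl

variable {G : E → Matrix (Fin n) (Fin n) ℍ[ℝ]}

theorem conj_diagonal_apply (d : Fin n → ℝ) (g : Matrix (Fin n) (Fin n) ℍ[ℝ]) (i j : Fin n) :
    (g * (Matrix.diagonal fun i => (d i : ℍ[ℝ])) * star g) i j
      = ∑ k, d k • (g i k * star (g j k)) := by
  rw [Matrix.mul_apply]
  refine Finset.sum_congr rfl fun k _ => ?_
  rw [Matrix.mul_diagonal, Matrix.star_apply, ← Quaternion.coe_commutes,
    Quaternion.coe_mul_eq_smul, smul_mul_assoc]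

/-- Since `G 0 = 1`, the product rule leaves only the terms `k = j` and `k = i`. It is used with `c
= 1`, where `G G* = 1` makes the derivative skew, and with `c = d`, where it differentiates `G D
G*`. -/
theorem fderiv_conj_apply (hG : ∀ i j, ContDiffAt ℝ ∞ (fun z => G z i j) 0) (hG0 : G 0 = 1)
    (c : Fin n → ℝ) (i j : Fin n) (u : E) :
    DifferentiableAt ℝ (fun z => ∑ k, c k • (G z i k * star (G z j k))) 0 ∧
    fderiv ℝ (fun z => ∑ k, c k • (G z i k * star (G z j k))) 0 u
      = c j • fderiv ℝ (fun z => G z i j) 0 u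
        + c i • star (fderiv ℝ (fun z => G z j i) 0 u) := by
  have hd : ∀ i j, HasFDerivAt (fun z => G z i j) (fderiv ℝ (fun z => G z i j) 0) 0 := fun i j =>
    ((hG i j).differentiableAt (by simp)).hasFDerivAt
  have h := HasFDerivAt.fun_sum (u := (Finset.univ : Finset (Fin n))) (x := (0 : E)) fun k _ =>
    ((hd i k).mul' (quatStarL.hasFDerivAt.comp
      (0 : E) (hd j k))).const_smul (c k)
  refine ⟨h.differentiableAt, ?_⟩
  have h' : HasFDerivAt (fun z => ∑ k, c k • (G z i k * star (G z j k))) _ 0 := h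
  rw [h'.fderiv, sum_apply]
  have hterm : ∀ k : Fin n, (c k • (G 0 i k * star (fderiv ℝ (fun z => G z j k) 0 u)
      + fderiv ℝ (fun z => G z i k) 0 u * star (G 0 j k)))
      = (if i = k then c k • star (fderiv ℝ (fun z => G z j k) 0 u) else 0)
        + (if j = k then c k • fderiv ℝ (fun z => G z i k) 0 u else 0) := by
    intro k
    rw [hG0, Matrix.one_apply, Matrix.one_apply, smul_add]
    split_ifs <;> simp
  refine (Finset.sum_congr rfl fun k _ => hterm k).trans ?_
  rw [Finset.sum_add_distrib, Finset.sum_ite_eq, Finset.sum_ite_eq, add_comm]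
  simp

variable {d : Fin n → ℝ} {hd : ∑ i, d i = 0} {F : E → QHerm n}

theorem fderiv_lift_skew (hG : ∀ i j, ContDiffAt ℝ ∞ (fun z => G z i j) 0) (hG0 : G 0 = 1)
    (hGu : ∀ᶠ z in 𝓝 0, G z * star (G z) = 1) (i j : Fin n) (u : E) :
    star (fderiv ℝ (fun z => G z j i) 0 u) = -fderiv ℝ (fun z => G z i j) 0 u := by
  have h1 := (fderiv_conj_apply hG hG0 (fun _ => 1) i j u).2
  have h2 : (fun z => ∑ k, (1 : ℝ) • (G z i k * star (G z j k))) =ᶠ[𝓝 0]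
      fun _ => (1 : Matrix (Fin n) (Fin n) ℍ[ℝ]) i j := by
    filter_upwards [hGu] with z hz
    rw [← hz, Matrix.mul_apply]
    simp [Matrix.star_apply]
  rw [h2.fderiv_eq, fderiv_fun_const] at h1
  simp only [one_smul] at h1
  exact eq_neg_of_add_eq_zero_right h1.symm

/-- The derivative of `G D G*` at `G = 1` is the commutator of the skew matrix `DG` with the
diagonal matrix `D`. -/
theorem fderiv_mat_apply (hF : DifferentiableAt ℝ F 0)
    (hG : ∀ i j, ContDiffAt ℝ ∞ (fun z => G z i j) 0) (hG0 : G 0 = 1)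
    (hGu : ∀ᶠ z in 𝓝 0, G z * star (G z) = 1)
    (hFG : ∀ᶠ z in 𝓝 0, (F z).mat = G z * (diagPoint d hd).mat * star (G z))
    (i j : Fin n) (u : E) :
    (fderiv ℝ F 0 u).mat i j = (d j - d i) • fderiv ℝ (fun z => G z i j) 0 u := by
  have h1 := (fderiv_conj_apply hG hG0 d i j u).2
  have h2 : (fun z => ∑ k, d k • (G z i k * star (G z j k))) =ᶠ[𝓝 0]
      fun z => (F z).mat i j := by
    filter_upwards [hFG] with z hz
    rw [hz, diagPoint_mat, conj_diagonal_apply]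
  have h3 : HasFDerivAt (fun z => (F z).mat i j)
      (((entryL i j).comp (matL n)).comp (fderiv ℝ F 0)) 0 :=
    HasFDerivAt.comp (g := (entryL i j).comp (matL n)) (0 : E)
      ((entryL i j).comp (matL n)).hasFDerivAt hF.hasFDerivAt
  rw [h2.fderiv_eq, h3.fderiv, fderiv_lift_skew hG hG0 hGu] at h1
  rw [sub_smul, sub_eq_add_neg, ← smul_neg]
  exact h1

/-- The rows of `g` have norm one, so `∑ d_k |g_ik|² = d_i + ∑ (d_k - d_i) |g_ik|²`. In this form
every term with nonzero coefficient vanishes to second order at `g = 1`. -/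
theorem height_lift (a : Fin n → ℝ) (ha : ∑ i, a i = 0) {g : Matrix (Fin n) (Fin n) ℍ[ℝ]}
    {X : QHerm n} (hg : g * star g = 1) (hX : X.mat = g * (diagPoint d hd).mat * star g) :
    height a ha X = (∑ i, a i * d i)
      + ∑ p : Fin n × Fin n, (a p.1 * (d p.2 - d p.1)) * ‖g p.1 p.2‖ ^ 2 := by
  have hre : ∀ (c : Fin n → ℝ) (i : Fin n), (∑ k, c k • (g i k * star (g i k))).re
      = ∑ k, c k * ‖g i k‖ ^ 2 := by
    intro c i
    rw [re_sum]
    refine Finset.sum_congr rfl fun k _ => ?_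
    rw [Quaternion.self_mul_star, Quaternion.re_smul, Quaternion.re_coe,
      Quaternion.normSq_eq_norm_mul_self, sq, smul_eq_mul]
  have h1 : ∀ i, ∑ k, ‖g i k‖ ^ 2 = 1 := by
    intro i
    have h := hre (fun _ => 1) i
    simp only [one_mul, one_smul] at h
    rw [← h]
    have h2 : (g * star g) i i = 1 := by rw [hg, Matrix.one_apply_eq]
    rw [Matrix.mul_apply] at h2
    simp only [Matrix.star_apply] at h2
    rw [h2, Quaternion.re_one]
  rw [height, inner_diagPoint, Fintype.sum_prod_type, ← Finset.sum_add_distrib]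
  refine Finset.sum_congr rfl fun i _ => ?_
  rw [hX, diagPoint_mat, conj_diagonal_apply, hre]
  have h2 : ∑ k, a i * (d k - d i) * ‖g i k‖ ^ 2
      = a i * ∑ k, d k * ‖g i k‖ ^ 2 - a i * d i * ∑ k, ‖g i k‖ ^ 2 := by
    rw [Finset.mul_sum, Finset.mul_sum, ← Finset.sum_sub_distrib]
    exact Finset.sum_congr rfl fun k _ => by ring
  rw [h2, h1]
  ring

end Lift

/-! ### Tangent spaces and the Hessian of the height function -/

theorem deriv_mat_diag_eq_zero {d : Fin n → ℝ} (hdi : Function.Injective d) (hd : ∑ i, d i = 0)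
    {γ : ℝ → QHerm n} (hγ : IsCurveAt (MulAction.orbit (Sp n) (diagPoint d hd))
      (diagPoint d hd) γ) (i : Fin n) : (deriv γ 0).mat i i = 0 := by
  obtain ⟨G, hG, hG0, hGe⟩ := exists_unitary_lift hdi hd hγ.contDiffAt hγ.1 hγ.eventually_mem
  have := fderiv_mat_apply (hγ.contDiffAt.differentiableAt (by simp)) hG hG0
    (hGe.mono fun _ h => h.1) (hGe.mono fun _ h => h.2) i i 1
  rw [sub_self, zero_smul, fderiv_apply_one_eq_deriv] at this
  exact this

theorem tangentSpaceOf_orbit {d : Fin n → ℝ} (hdi : Function.Injective d) (hd : ∑ i, d i = 0) :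
    tangentSpaceOf (MulAction.orbit (Sp n) (diagPoint d hd)) (diagPoint d hd)
      = offDiagSub n := by
  apply le_antisymm
  · refine Submodule.span_le.2 ?_
    rintro v ⟨γ, hγ, rfl⟩
    exact deriv_mat_diag_eq_zero hdi hd hγ
  · intro Y hY
    refine Submodule.subset_span ?_
    obtain ⟨h1, h2⟩ := isCurveAt_expConj (diagPoint d hd) (star_skewOf d ⟨Y, hY⟩)
    refine ⟨_, h1, ?_⟩
    rw [h2.deriv, commutator_skewOf hdi, hermProj_mat]

/-- A matrix commuting with `X` is normal to the orbit at `X`. Transport by the isometry `g⁻¹` moves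
`X` to `Diag(d)`, where tangent vectors have zero diagonal and matrices commuting with `Diag(d)` are
diagonal. -/
theorem inner_deriv_eq_zero_of_commute {d : Fin n → ℝ} (hdi : Function.Injective d)
    (hd : ∑ i, d i = 0) {X N : QHerm n} (hX : X ∈ MulAction.orbit (Sp n) (diagPoint d hd))
    (hN : N.mat * X.mat = X.mat * N.mat) {γ : ℝ → QHerm n}
    (hγ : IsCurveAt (MulAction.orbit (Sp n) (diagPoint d hd)) X γ) :
    inner ℝ N (deriv γ 0) = 0 := by
  obtain ⟨g, rfl⟩ := hX
  have hγ' : IsCurveAt (MulAction.orbit (Sp n) (diagPoint d hd)) (diagPoint d hd)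
      (fun t => g⁻¹ • γ t) := by
    obtain ⟨h0, ε, hε, hs, hM⟩ := hγ
    refine ⟨by simp only [h0]; exact inv_smul_smul g _, ε, hε, (actL g⁻¹).contDiff.comp_contDiffOn hs,
      fun t ht => ?_⟩
    obtain ⟨k, hk⟩ := hM t ht
    refine ⟨g⁻¹ * k, ?_⟩
    simp only [← hk]
    exact mul_smul _ _ _
  have hder : deriv (fun t => g⁻¹ • γ t) 0 = g⁻¹ • deriv γ 0 :=
    ((actL g⁻¹).hasFDerivAt.comp_hasDerivAt (0 : ℝ) hγ.hasDerivAt).deriv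
  have hdiag := deriv_mat_diag_eq_zero hdi hd hγ'
  rw [hder] at hdiag
  rw [← inner_smul_smul_action g⁻¹]
  have hcomm : (g⁻¹ • N).mat * (diagPoint d hd).mat = (diagPoint d hd).mat * (g⁻¹ • N).mat := by
    have hg : g.1 * star g.1 = 1 := Unitary.mul_star_self_of_mem g.2
    have hg' : star g.1 * g.1 = 1 := Unitary.star_mul_self_of_mem g.2
    have hD : (diagPoint d hd).mat = star g.1 * (g • diagPoint d hd).mat * g.1 := by
      rw [mat_smul_action]
      calc (diagPoint d hd).mat = (star g.1 * g.1) * (diagPoint d hd).mat * (star g.1 * g.1) := by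
            rw [hg', one_mul, mul_one]
        _ = _ := by simp only [mul_assoc]
    have hN' : (g⁻¹ • N).mat = star g.1 * N.mat * g.1 := by
      rw [mat_smul_action]
      change star g.1 * N.mat * star (star g.1) = _
      rw [star_star]
    have hX' : N.mat * (g • diagPoint d hd).mat = (g • diagPoint d hd).mat * N.mat := hN
    rw [hN', hD]
    calc _ = star g.1 * (N.mat * ((g.1 * star g.1) * (g • diagPoint d hd).mat)) * g.1 := by
          simp only [mul_assoc]
      _ = star g.1 * ((g • diagPoint d hd).mat * ((g.1 * star g.1) * N.mat)) * g.1 := by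
          rw [hg, one_mul, one_mul, hX']
      _ = _ := by simp only [mul_assoc]
  rw [inner_eq_sum]
  refine Finset.sum_eq_zero fun i _ => Finset.sum_eq_zero fun j _ => ?_
  by_cases hij : i = j
  · rw [← hij, hdiag, inner_zero_right]
  · have h := congrFun (congrFun hcomm i) j
    rw [diagPoint_mat, Matrix.mul_diagonal, Matrix.diagonal_mul, ← Quaternion.coe_commutes,
      ← sub_eq_zero, ← sub_mul, mul_eq_zero, ← Quaternion.coe_sub] at h
    rcases h with h | h
    · exact absurd (sub_eq_zero.1 (Quaternion.coe_injective (h.trans Quaternion.coe_zero.symm))) fun h' => hij (hdi h').symm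
    · rw [h, inner_zero_left]

/-- The Hessian of the height function at `Diag(d)`. -/
def hessForm (a d : Fin n → ℝ) : LinearMap.BilinForm ℝ (QHerm n) :=
  LinearMap.mk₂ ℝ
    (fun Y Z => ∑ i, ∑ j, (a i - a j) / (d j - d i) * inner ℝ (Y.mat i j) (Z.mat i j))
    (by
      intro X Y Z
      simp only [QHerm.mat_add, Matrix.add_apply, inner_add_left, mul_add,
        Finset.sum_add_distrib])
    (by
      intro c X Y
      simp only [QHerm.mat_smul, Matrix.smul_apply, real_inner_smul_left, smul_eq_mul,
        Finset.mul_sum]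
      exact Finset.sum_congr rfl fun i _ => Finset.sum_congr rfl fun j _ => by ring)
    (by
      intro X Y Z
      simp only [QHerm.mat_add, Matrix.add_apply, inner_add_right, mul_add,
        Finset.sum_add_distrib])
    (by
      intro c X Y
      simp only [QHerm.mat_smul, Matrix.smul_apply, real_inner_smul_right, smul_eq_mul,
        Finset.mul_sum]
      exact Finset.sum_congr rfl fun i _ => Finset.sum_congr rfl fun j _ => by ring)

theorem hessForm_apply (a d : Fin n → ℝ) (Y Z : QHerm n) : hessForm a d Y Z
    = ∑ i, ∑ j, (a i - a j) / (d j - d i) * inner ℝ (Y.mat i j) (Z.mat i j) := rfl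

/-- Lifting an arbitrary local parametrization to unitary matrices turns the height into the sum of
squares of `height_lift`, whose second derivative depends only on `DG`, hence only on the tangent
vectors. -/
theorem isHessianAt_hessForm {d : Fin n → ℝ} (hdi : Function.Injective d) (hd : ∑ i, d i = 0)
    (a : Fin n → ℝ) (ha : ∑ i, a i = 0) :
    IsHessianAt (MulAction.orbit (Sp n) (diagPoint d hd)) (height a ha) (diagPoint d hd)
      ((hessForm a d).restrict _) := by
  intro m φ U hφ u v Y Z hY hZ
  have hU : U ∈ 𝓝 0 := hφ.isOpen.mem_nhds hφ.zero_mem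
  have hs : ContDiffAt ℝ ∞ φ 0 := hφ.smooth.contDiffAt hU
  have hM : ∀ᶠ z in 𝓝 0, φ z ∈ MulAction.orbit (Sp n) (diagPoint d hd) := by
    obtain ⟨W, -, himg, -⟩ := hφ.homeo
    filter_upwards [hU] with z hz
    exact (himg.subset ⟨z, hz, rfl⟩).1
  obtain ⟨G, hG, hG0, hGe⟩ := exists_unitary_lift hdi hd hs hφ.map_zero hM
  have hGu := hGe.mono fun _ h => h.1
  have hGF := hGe.mono fun _ h => h.2
  have hh : (fun z => height a ha (φ z)) =ᶠ[𝓝 0] fun z => (∑ i, a i * d i)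
      + ∑ p : Fin n × Fin n, (a p.1 * (d p.2 - d p.1)) * ‖G z p.1 p.2‖ ^ 2 := by
    filter_upwards [hGe] with z hz
    exact height_lift a ha hz.1 hz.2
  rw [(Filter.EventuallyEq.iteratedFDeriv (𝕜 := ℝ) hh 2).eq_of_nhds]
  rw [iteratedFDeriv_two_sum_norm_sq (G := fun (p : Fin n × Fin n) z => G z p.1 p.2)
    Finset.univ _ _ (fun p => hG p.1 p.2), Fintype.sum_prod_type]
  · rw [LinearMap.BilinForm.restrict_apply, LinearMap.domRestrict_apply, hessForm_apply, hY, hZ]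
    set s : Fin n → Fin n → ℝ := fun i j =>
      inner ℝ (fderiv ℝ (fun z => G z i j) 0 u) (fderiv ℝ (fun z => G z i j) 0 v) with hsdef
    -- Because `DG` is skew-Hermitian, `s` is symmetric, so the coefficients `a i * (d j - d i)` may
    -- be symmetrized to `(a i - a j) * (d j - d i)`.
    have hsymm : ∀ i j, s i j = s j i := by
      intro i j
      have h1 := fderiv_lift_skew hG hG0 hGu j i u
      have h2 := fderiv_lift_skew hG hG0 hGu j i v
      simp only [hsdef]
      rw [← neg_eq_iff_eq_neg] at h1 h2
      rw [← h1, ← h2, inner_neg_neg, Quaternion.inner_def, Quaternion.inner_def, star_star,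
        quat_re_mul_comm, ← Quaternion.re_star, star_mul, star_star]
    -- Each tangent vector contributes a factor `d j - d i`, by `fderiv_mat_apply`; one of the two
    -- cancels the denominator.
    have h1 : ∀ i j, (a i - a j) / (d j - d i)
        * inner ℝ ((fderiv ℝ φ 0 u).mat i j) ((fderiv ℝ φ 0 v).mat i j)
        = a i * (d j - d i) * s i j + a j * (d i - d j) * s j i := by
      intro i j
      rw [fderiv_mat_apply (hs.differentiableAt (by simp)) hG hG0 hGu hGF,
        fderiv_mat_apply (hs.differentiableAt (by simp)) hG hG0 hGu hGF, real_inner_smul_left,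
        real_inner_smul_right, hsymm j i]
      by_cases hij : i = j
      · rw [hij]; simp
      · have : d j - d i ≠ 0 := sub_ne_zero.2 fun h' => hij (hdi h').symm
        field_simp
        ring
    rw [Finset.sum_congr rfl fun i _ => Finset.sum_congr rfl fun j _ => h1 i j]
    simp only [Finset.sum_add_distrib]
    rw [Finset.sum_comm (f := fun i j => a j * (d i - d j) * s j i), ← two_mul, Finset.mul_sum]
    refine Finset.sum_congr rfl fun i _ => ?_
    rw [Finset.mul_sum]
    exact Finset.sum_congr rfl fun j _ => by ring
  · intro p hp
    simp only [hG0]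
    refine Matrix.one_apply_ne fun h => hp ?_
    rw [h]
    simp

end QFlag
end

noncomputable section

namespace QFlag

variable {n : ℕ}

/-! ### The points given by permutations and the critical set -/

theorem comp_perm_sum {r : Fin n → ℝ} (hr : ∑ i, r i = 0) (w : Equiv.Perm (Fin n)) :
    ∑ i, r (w i) = 0 := (Equiv.sum_comp w r).trans hr

theorem permPoint_mem_flagManifold (r : Fin n → ℝ) (hr : ∑ i, r i = 0)
    (w : Equiv.Perm (Fin n)) : permPoint r hr w ∈ flagManifold r hr := by
  set g : Matrix (Fin n) (Fin n) ℍ[ℝ] := Matrix.of fun i j => if w i = j then 1 else 0 with hg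
  have h1 : ∀ d : Fin n → ℝ, g * (Matrix.diagonal fun i => (d i : ℍ[ℝ])) * star g
      = Matrix.diagonal fun i => (d (w i) : ℍ[ℝ]) := by
    intro d
    ext1 i j
    rw [conj_diagonal_apply, Finset.sum_eq_single (w i)]
    · by_cases hij : i = j
      · rw [hij, Matrix.diagonal_apply_eq]
        simp only [hg, Matrix.of_apply, if_true, star_one, mul_one]
        rw [← Quaternion.coe_mul_eq_smul, mul_one]
      · rw [Matrix.diagonal_apply_ne _ hij]
        have : w j ≠ w i := fun h => hij (w.injective h).symm
        simp [hg, this]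
    · intro k _ hk
      simp [hg, Ne.symm hk]
    · simp
  -- The identity matrix is the case `d = 1` of `h1`.
  have h2 : g * star g = 1 := by
    have h := h1 fun _ => 1
    simp only [Quaternion.coe_one, Matrix.diagonal_one, mul_one] at h
    exact h
  have h3 : star g * g = 1 := by
    ext1 i j
    rw [Matrix.mul_apply, Finset.sum_eq_single (w.symm i)]
    · by_cases hij : i = j
      · rw [hij, Matrix.one_apply_eq]
        simp [hg, Matrix.star_apply]
      · simp [hg, Matrix.star_apply, hij]
    · intro k _ hk
      have : w k ≠ i := fun h => hk (by rw [← h, Equiv.symm_apply_apply])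
      simp [hg, Matrix.star_apply, this]
    · simp
  refine ⟨⟨g, Unitary.mem_iff.2 ⟨h3, h2⟩⟩, ?_⟩
  apply QHerm.ext_mat
  exact h1 r

/-- Any permutation point may serve as base point, so the local results at `Diag(d)` apply at `w`
with `d = r ∘ w`. -/
theorem flagManifold_eq_orbit (r : Fin n → ℝ) (hr : ∑ i, r i = 0) (w : Equiv.Perm (Fin n)) :
    flagManifold r hr
      = MulAction.orbit (Sp n) (diagPoint (fun i => r (w i)) (comp_perm_sum hr w)) :=
  (MulAction.orbit_eq_iff.2 (permPoint_mem_flagManifold r hr w)).symm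

theorem permPoint_mat (r : Fin n → ℝ) (hr : ∑ i, r i = 0) (w : Equiv.Perm (Fin n)) :
    (permPoint r hr w).mat = Matrix.diagonal fun i => (r (w i) : ℍ[ℝ]) := rfl

theorem permPoint_injective {r : Fin n → ℝ} (hri : Function.Injective r) (hr : ∑ i, r i = 0) :
    Function.Injective (permPoint r hr) := by
  intro w w' h
  ext1 i
  have h1 := congrArg (fun X : QHerm n => X.mat i i) h
  simp only [permPoint_mat, Matrix.diagonal_apply_eq] at h1
  exact hri (Quaternion.coe_injective h1)

/-- By homogeneity, the chart at the base point is carried to every other point by the linear action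
of `Sp n`. -/
theorem isSmoothSubmanifold_flagManifold {r : Fin n → ℝ} (hri : Function.Injective r)
    (hr : ∑ i, r i = 0) : IsSmoothSubmanifold (2 * n * (n - 1)) (flagManifold r hr) := by
  rintro _ ⟨g, rfl⟩
  obtain ⟨⟨φ, U, h⟩, -⟩ := exists_orbit_chart hri hr
  refine ⟨_, U, h.map (L := actL g) (L' := actL g⁻¹) (fun v => ?_) (fun v => ?_) fun v => ?_⟩
  · exact smul_inv_smul g v
  · exact inv_smul_smul g v
  · refine ⟨fun hv => ?_, fun hv => MulAction.mem_orbit_of_mem_orbit g hv⟩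
    have := MulAction.mem_orbit_of_mem_orbit g⁻¹ hv
    rwa [actL_apply, inv_smul_smul] at this

theorem hermProj_mat_of_mem {Z : Matrix (Fin n) (Fin n) ℍ[ℝ]} (hZ : star Z = Z)
    (htr : Z.trace.re = 0) : (hermProj n Z).mat = Z := by
  have h : Z ∈ qhermSubmodule n := ⟨hZ, by rw [trace_eq_re hZ, htr, Quaternion.coe_zero]⟩
  exact congrArg QHerm.mat (hermProj_mat (⟨Z, h⟩ : QHerm n))

theorem hasDerivAt_height {γ : ℝ → QHerm n} {v : QHerm n} {t : ℝ} (hγ : HasDerivAt γ v t)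
    (a : Fin n → ℝ) (ha : ∑ i, a i = 0) :
    HasDerivAt (fun s => height a ha (γ s)) (inner ℝ (diagPoint a ha) v) t :=
  (innerSL ℝ (diagPoint a ha)).hasFDerivAt.comp_hasDerivAt t hγ

/-- Test criticality on the curve generated by `S = [X, A]`: the derivative of the height along it
is `Re tr(A [S, X]) = -‖S‖²`, which forces `S = 0`. -/
theorem commute_of_mem_critSet {r a : Fin n → ℝ} (hr : ∑ i, r i = 0) (ha : ∑ i, a i = 0)
    {X : QHerm n} (hX : X ∈ critSet (flagManifold r hr) (height a ha)) :
    X.mat * (diagPoint a ha).mat = (diagPoint a ha).mat * X.mat := by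
  obtain ⟨hXM, hcrit⟩ := hX
  set A := diagPoint a ha with hA
  set S := X.mat * A.mat - A.mat * X.mat with hSdef
  have hXs : star X.mat = X.mat := X.mat_star
  have hAs : star A.mat = A.mat := A.mat_star
  have hS : star S = -S := by
    rw [hSdef, star_sub, star_mul, star_mul, hXs, hAs, neg_sub]
  obtain ⟨h1, h2⟩ := isCurveAt_expConj X hS
  have hM : MulAction.orbit (Sp n) X = flagManifold r hr := MulAction.orbit_eq_iff.2 hXM
  rw [hM] at h1
  have h3 := (hasDerivAt_height h2 a ha).unique (hcrit _ h1)
  have h4 : (S * X.mat - X.mat * S).trace.re = 0 := by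
    rw [Matrix.trace_sub, Quaternion.re_sub, re_trace_mul_comm, sub_self]
  rw [inner_def, hermProj_mat_of_mem (by
    rw [star_sub, star_mul, star_mul, hXs, hS]; noncomm_ring) h4] at h3
  -- Only the real part of the trace is cyclic over the quaternions; it rewrites the left side as
  -- `Re tr([X, A] S)`.
  have h5 : (A.mat * (S * X.mat - X.mat * S)).trace.re = -(S * S.conjTranspose).trace.re := by
    have h6 : S.conjTranspose = -S := hS
    rw [h6, mul_neg, Matrix.trace_neg, Quaternion.re_neg, neg_neg, mul_sub, Matrix.trace_sub,
      Quaternion.re_sub, ← mul_assoc, ← mul_assoc, re_trace_mul_comm (A.mat * S), ← mul_assoc,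
      ← Quaternion.re_sub, ← Matrix.trace_sub, ← sub_mul]
  rw [h5, neg_eq_zero, re_trace_mul_star] at h3
  have h7 : S = 0 := by
    ext1 i j
    have h8 := (Finset.sum_eq_zero_iff_of_nonneg fun i _ => Finset.sum_nonneg
      fun j _ => Quaternion.normSq_nonneg).1 h3 i (Finset.mem_univ i)
    have h9 := (Finset.sum_eq_zero_iff_of_nonneg
      fun j _ => Quaternion.normSq_nonneg).1 h8 j (Finset.mem_univ j)
    exact Quaternion.normSq_eq_zero.1 h9
  exact sub_eq_zero.1 h7

/-- Commuting with a diagonal matrix with distinct real entries makes `X` diagonal. In `X g = g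
Diag(r)`, a nonzero entry in column `j` of `g` shows that `r j` occurs on the diagonal of `X`;
distinctness of the `r j` turns this into a permutation. -/
theorem exists_perm_of_mem_critSet {r a : Fin n → ℝ} (hri : Function.Injective r)
    (hr : ∑ i, r i = 0) (hai : Function.Injective a) (ha : ∑ i, a i = 0)
    {X : QHerm n} (hX : X ∈ critSet (flagManifold r hr) (height a ha)) :
    ∃ w, permPoint r hr w = X := by
  have hcomm := commute_of_mem_critSet hr ha hX
  have hoff : ∀ i j, i ≠ j → X.mat i j = 0 := by
    intro i j hij
    have h := congrFun (congrFun hcomm i) j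
    rw [diagPoint_mat, Matrix.mul_diagonal, Matrix.diagonal_mul, ← Quaternion.coe_commutes,
      ← sub_eq_zero, ← sub_mul, mul_eq_zero, ← Quaternion.coe_sub] at h
    refine h.resolve_left fun h => hij (hai ?_).symm
    exact sub_eq_zero.1 (Quaternion.coe_injective (h.trans Quaternion.coe_zero.symm))
  have hXdiag : X.mat = Matrix.diagonal fun i => ((X.mat i i).re : ℍ[ℝ]) := by
    ext1 i j
    by_cases h : i = j
    · rw [h, Matrix.diagonal_apply_eq]
      exact mat_diag_eq_re X j
    · rw [Matrix.diagonal_apply_ne _ h, hoff i j h]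
  obtain ⟨g, hg⟩ := hX.1
  have hg' : star g.1 * g.1 = 1 := Unitary.star_mul_self_of_mem g.2
  have hgX : X.mat * g.1 = g.1 * (diagPoint r hr).mat := by
    rw [← hg]
    change g.1 * (diagPoint r hr).mat * star g.1 * g.1 = _
    rw [mul_assoc, hg', mul_one]
  have hcol : ∀ j, ∃ i, g.1 i j ≠ 0 := by
    intro j
    by_contra! h
    have h1 := congrFun (congrFun hg' j) j
    rw [Matrix.mul_apply, Matrix.one_apply_eq] at h1
    simp [h] at h1
  choose f hf using hcol
  have hfr : ∀ j, (X.mat (f j) (f j)).re = r j := by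
    intro j
    have h := congrFun (congrFun hgX (f j)) j
    rw [diagPoint_mat, hXdiag, Matrix.mul_diagonal, Matrix.diagonal_mul,
      ← Quaternion.coe_commutes] at h
    exact Quaternion.coe_injective (mul_right_cancel₀ (hf j) h)
  have hfi : Function.Injective f := fun j k hjk => hri (by rw [← hfr j, ← hfr k, hjk])
  let e : Equiv.Perm (Fin n) := Equiv.ofBijective f (Finite.injective_iff_bijective.1 hfi)
  refine ⟨e.symm, QHerm.ext_mat ?_⟩
  rw [hXdiag, permPoint_mat]
  congr 1
  funext i
  rw [← hfr (e.symm i)]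
  have : f (e.symm i) = i := e.apply_symm_apply i
  rw [this]

/-- The diagonal matrix `A` commutes with the diagonal point, hence is normal to the orbit there. -/
theorem permPoint_mem_critSet {r a : Fin n → ℝ} (hri : Function.Injective r)
    (hr : ∑ i, r i = 0) (ha : ∑ i, a i = 0) (w : Equiv.Perm (Fin n)) :
    permPoint r hr w ∈ critSet (flagManifold r hr) (height a ha) := by
  refine ⟨permPoint_mem_flagManifold r hr w, fun γ hγ => ?_⟩
  rw [flagManifold_eq_orbit r hr w] at hγ
  have h := hasDerivAt_height hγ.hasDerivAt a ha
  have hz := inner_deriv_eq_zero_of_commute (hri.comp w.injective) (comp_perm_sum hr w)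
    (MulAction.mem_orbit_self _) (N := diagPoint a ha) (by
      change Matrix.diagonal _ * Matrix.diagonal _ = Matrix.diagonal _ * Matrix.diagonal _
      rw [Matrix.diagonal_mul_diagonal, Matrix.diagonal_mul_diagonal]
      congr 1
      funext i
      exact Quaternion.coe_commutes _ _) hγ
  rwa [hz] at h

theorem flagLine_permPoint {r : Fin n → ℝ} (hri : Function.Injective r) (hr : ∑ i, r i = 0)
    (w : Equiv.Perm (Fin n)) (i : Fin n) :
    flagLine r (permPoint r hr w) (w i) = Submodule.span ℍ[ℝ] {Pi.single i 1} := by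
  have hmem : ∀ h : Fin n → ℍ[ℝ], h ∈ flagLine r (permPoint r hr w) (w i) ↔
      ∀ j, h j * (r (w j) : ℍ[ℝ]) = (r (w i) : ℍ[ℝ]) * h j := by
    intro h
    change Matrix.vecMul h (permPoint r hr w).mat.conjTranspose = _ ↔ _
    rw [QHerm.mat_star, permPoint_mat, funext_iff]
    exact forall_congr' fun j => by rw [Matrix.vecMul_diagonal]
  ext h
  rw [hmem, Submodule.mem_span_singleton]
  constructor
  · intro hh
    refine ⟨h i, ?_⟩
    funext j
    by_cases hij : j = i
    · subst hij
      simp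
    · have h1 := hh j
      rw [← Quaternion.coe_commutes, ← sub_eq_zero, ← sub_mul, mul_eq_zero,
        ← Quaternion.coe_sub] at h1
      have h2 := h1.resolve_left fun h => hij (w.injective (hri
        (sub_eq_zero.1 (Quaternion.coe_injective (h.trans Quaternion.coe_zero.symm)))))
      simp [hij, h2]
  · rintro ⟨c, rfl⟩ j
    by_cases hij : j = i
    · subst hij
      exact (Quaternion.coe_commutes _ _).symm
    · simp [hij]

/-- The sign of this product decides both the direction of the gradient on the sphere and the sign
of the Hessian eigenvalue on the pair `pq`. -/
theorem height_permPoint_sub {r a : Fin n → ℝ} (hr : ∑ i, r i = 0) (ha : ∑ i, a i = 0)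
    (w : Equiv.Perm (Fin n)) {p q : Fin n} (hpq : p ≠ q) :
    height a ha (permPoint r hr w) - height a ha (permPoint r hr (w * Equiv.swap p q))
      = (a p - a q) * (r (w p) - r (w q)) := by
  rw [height, height, inner_diagPoint, inner_diagPoint, ← Finset.sum_sub_distrib,
    Fintype.sum_eq_add p q hpq]
  · simp only [permPoint_mat, Matrix.diagonal_apply_eq, Quaternion.re_coe, Equiv.Perm.mul_apply,
      Equiv.swap_apply_left, Equiv.swap_apply_right]
    ring
  · rintro i ⟨hp, hq⟩
    simp only [permPoint_mat, Matrix.diagonal_apply_eq, Quaternion.re_coe, Equiv.Perm.mul_apply,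
      Equiv.swap_apply_of_ne_of_ne hp hq, sub_self]

end QFlag
end

noncomputable section

namespace SubmanifoldGeom

variable {V : Type*} [NormedAddCommGroup V] [InnerProductSpace ℝ V]

/-! ### Round spheres -/

theorem norm_add_smul_of_orthogonal {N u : V} (hu : ‖u‖ = ‖N‖) (hNu : inner ℝ u N = 0)
    {x y : ℝ} (hxy : x ^ 2 + y ^ 2 = 1) : ‖x • N + y • u‖ = ‖N‖ := by
  rw [← sq_eq_sq₀ (norm_nonneg _) (norm_nonneg _), norm_add_sq_real, norm_smul, norm_smul,
    real_inner_smul_left, real_inner_smul_right, real_inner_comm, hNu, hu, mul_pow, mul_pow,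
    Real.norm_eq_abs, Real.norm_eq_abs, sq_abs, sq_abs]
  linear_combination ‖N‖ ^ 2 * hxy

/-- Differentiating the two defining conditions gives one inclusion; great circles through `c + N`
give the other. -/
theorem tangentSpaceOf_roundSphere [FiniteDimensional ℝ V] {c N : V} {E : Submodule ℝ V}
    (hN : N ∈ E) (hN0 : N ≠ 0) (v : V) :
    v ∈ tangentSpaceOf (roundSphere c E ‖N‖) (c + N) ↔ v ∈ E ∧ inner ℝ N v = 0 := by
  constructor
  · intro hv
    have hle : tangentSpaceOf (roundSphere c E ‖N‖) (c + N)
        ≤ E ⊓ LinearMap.ker (innerSL ℝ N).toLinearMap := by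
      refine Submodule.span_le.2 ?_
      rintro v ⟨γ, hγ, rfl⟩
      have hd := hγ.hasDerivAt.sub_const c
      have h0 : γ 0 - c = N := by rw [hγ.1, add_sub_cancel_left]
      refine ⟨?_, ?_⟩
      · rw [← Submodule.orthogonal_orthogonal E]
        refine (Submodule.mem_orthogonal _ _).2 fun x hx => ?_
        have h1 : HasDerivAt (fun t => inner ℝ x (γ t - c)) (inner ℝ x (deriv γ 0)) 0 :=
          (innerSL ℝ x).hasFDerivAt.comp_hasDerivAt (0 : ℝ) hd
        have h2 : (fun t => inner ℝ x (γ t - c)) =ᶠ[𝓝 0] fun _ => (0 : ℝ) := by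
          filter_upwards [hγ.eventually_mem] with t ht
          exact Submodule.inner_left_of_mem_orthogonal ht.1 hx
        exact (h1.congr_of_eventuallyEq h2.symm).unique (hasDerivAt_const _ _)
      · have h1 := hd.norm_sq
        have h2 : (fun t => ‖γ t - c‖ ^ 2) =ᶠ[𝓝 0] fun _ => ‖N‖ ^ 2 := by
          filter_upwards [hγ.eventually_mem] with t ht
          rw [ht.2]
        have h3 := (h1.congr_of_eventuallyEq h2.symm).unique (hasDerivAt_const _ _)
        rw [h0] at h3
        change inner ℝ N (deriv γ 0) = 0
        linarith
    exact hle hv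
  · rintro ⟨hvE, hv⟩
    by_cases hv0 : v = 0
    · rw [hv0]
      exact Submodule.zero_mem _
    have hvn : ‖v‖ ≠ 0 := norm_ne_zero_iff.2 hv0
    have hNn : ‖N‖ ≠ 0 := norm_ne_zero_iff.2 hN0
    -- Rescaling `v` to the length of `N` makes `c + cos t • N + sin t • u` a great circle.
    set u := (‖N‖ / ‖v‖) • v with hu
    have hun : ‖u‖ = ‖N‖ := by
      rw [hu, norm_smul, norm_div, norm_norm, norm_norm, div_mul_cancel₀ _ hvn]
    have hNu : inner ℝ N u = 0 := by rw [hu, real_inner_smul_right, hv, mul_zero]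
    have hmem : u ∈ tangentSpaceOf (roundSphere c E ‖N‖) (c + N) := by
      refine Submodule.subset_span ⟨fun t => c + Real.cos t • N + Real.sin t • u,
        ⟨by simp, 1, one_pos, ?_, fun t _ => ⟨?_, ?_⟩⟩, ?_⟩
      · exact (((contDiff_const.add (Real.contDiff_cos.smul contDiff_const)).add
          (Real.contDiff_sin.smul contDiff_const))).contDiffOn
      · simp only [add_assoc, add_sub_cancel_left]
        exact E.add_mem (E.smul_mem _ hN) (E.smul_mem _ (E.smul_mem _ hvE))
      · simp only [add_assoc, add_sub_cancel_left]
        exact norm_add_smul_of_orthogonal hun (by rw [real_inner_comm, hNu])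
          (Real.cos_sq_add_sin_sq t)
      · have h := (((Real.hasDerivAt_cos 0).smul_const N).const_add c).add
          ((Real.hasDerivAt_sin 0).smul_const u)
        have h' : HasDerivAt (fun t => c + Real.cos t • N + Real.sin t • u) _ 0 := h
        rw [h'.deriv]
        simp
    have hvu : v = (‖v‖ / ‖N‖) • u := by
      rw [hu, smul_smul, div_mul_div_comm, mul_comm, div_self (mul_ne_zero hNn hvn), one_smul]
    rw [hvu]
    exact Submodule.smul_mem _ _ hmem

/-- On a round sphere, a linear function proportional to `⟨N, ·⟩` is largest exactly at `N`. -/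
theorem inner_lt_of_mem_sphere {N Y : V} (hY : ‖Y‖ = ‖N‖) (h : Y ≠ N) :
    inner ℝ N Y < inner ℝ N N := by
  have h1 : 0 < ‖Y - N‖ ^ 2 := by
    have := norm_pos_iff.2 (sub_ne_zero.2 h)
    positivity
  rw [norm_sub_sq_real, hY, real_inner_comm] at h1
  rw [real_inner_self_eq_norm_sq]
  linarith

end SubmanifoldGeom

/-! ### The solution of the gradient equation along a meridian -/

theorem Real.tanh_eq_one_sub (x : ℝ) : Real.tanh x = 1 - 2 / (Real.exp (2 * x) + 1) := by
  rw [Real.tanh_eq_sinh_div_cosh, Real.sinh_eq, Real.cosh_eq, two_mul, Real.exp_add, Real.exp_neg]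
  have := Real.exp_pos x
  field_simp
  ring

theorem Real.tendsto_tanh_atTop_one : Filter.Tendsto Real.tanh Filter.atTop (𝓝 1) := by
  have h1 : Filter.Tendsto (fun x : ℝ => Real.exp (2 * x) + 1) Filter.atTop Filter.atTop :=
    Filter.tendsto_atTop_add_const_right _ _
      (Real.tendsto_exp_atTop.comp (Filter.tendsto_id.const_mul_atTop two_pos))
  have h2 : Filter.Tendsto (fun x : ℝ => 1 - 2 / (Real.exp (2 * x) + 1)) Filter.atTop
      (𝓝 (1 - 0)) := tendsto_const_nhds.sub (h1.const_div_atTop 2)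
  rw [sub_zero] at h2
  exact h2.congr fun x => (Real.tanh_eq_one_sub x).symm

theorem Real.tendsto_tanh_atBot_neg_one : Filter.Tendsto Real.tanh Filter.atBot (𝓝 (-1)) := by
  have := (Real.tendsto_tanh_atTop_one.comp Filter.tendsto_neg_atBot_atTop).neg
  refine this.congr fun x => ?_
  simp [Real.tanh_neg]

/-- With `cos θ = tanh x` this says `sin θ = 1 / cosh x`; it matches the flow with the angular
description of a meridian, and gives the limits of `1 / cosh` from those of `tanh`. -/
theorem Real.inv_cosh_eq_sqrt (x : ℝ) : (Real.cosh x)⁻¹ = √(1 - Real.tanh x ^ 2) := by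
  have hc := Real.cosh_pos x
  have h : 1 - Real.tanh x ^ 2 = ((Real.cosh x)⁻¹) ^ 2 := by
    rw [Real.tanh_eq_sinh_div_cosh]
    field_simp
    linarith [Real.cosh_sq x]
  rw [h, Real.sqrt_sq (by positivity)]

theorem Real.tanh_sq_add_inv_cosh_sq (x : ℝ) : Real.tanh x ^ 2 + ((Real.cosh x)⁻¹) ^ 2 = 1 := by
  have hc := Real.cosh_pos x
  rw [Real.tanh_eq_sinh_div_cosh]
  field_simp
  linarith [Real.cosh_sq x]

theorem Real.hasDerivAt_inv_cosh (x : ℝ) :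
    HasDerivAt (fun x => (Real.cosh x)⁻¹) (-(Real.tanh x * (Real.cosh x)⁻¹)) x := by
  have hc := Real.cosh_pos x
  refine ((Real.hasDerivAt_cosh x).inv hc.ne').congr_deriv ?_
  rw [Real.tanh_eq_sinh_div_cosh]
  field_simp

theorem Real.hasDerivAt_tanh_inv_cosh (x : ℝ) :
    HasDerivAt Real.tanh (((Real.cosh x)⁻¹) ^ 2) x := by
  have hc := Real.cosh_pos x
  have h := (Real.hasDerivAt_sinh x).div (Real.hasDerivAt_cosh x) hc.ne'
  have h' : HasDerivAt Real.tanh _ x :=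
    h.congr_of_eventuallyEq (Filter.Eventually.of_forall Real.tanh_eq_sinh_div_cosh)
  convert h' using 1
  field_simp
  linarith [Real.cosh_sq x]

namespace SubmanifoldGeom

variable {V : Type*} [NormedAddCommGroup V] [InnerProductSpace ℝ V]

/-- The solution of the gradient equation which runs along the meridian through `c + u`. -/
def meridianFlow (c N u : V) (k t : ℝ) : V :=
  c + (Real.tanh (k * t) • N + (Real.cosh (k * t))⁻¹ • u)

theorem contDiff_meridianFlow (c N u : V) (k : ℝ) : ContDiff ℝ ∞ (meridianFlow c N u k) := by
  have h1 : ContDiff ℝ ∞ fun t : ℝ => k * t := contDiff_const.mul contDiff_id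
  have hc : ContDiff ℝ ∞ fun t : ℝ => (Real.cosh (k * t))⁻¹ :=
    (Real.contDiff_cosh.comp h1).inv fun t => (Real.cosh_pos _).ne'
  have ht : ContDiff ℝ ∞ fun t : ℝ => Real.tanh (k * t) := by
    have : (fun t : ℝ => Real.tanh (k * t))
        = fun t => Real.sinh (k * t) * (Real.cosh (k * t))⁻¹ := by
      funext t
      rw [Real.tanh_eq_sinh_div_cosh, div_eq_mul_inv]
    rw [this]
    exact (Real.contDiff_sinh.comp h1).mul hc
  exact contDiff_const.add ((ht.smul contDiff_const).add (hc.smul contDiff_const))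

/-- The identity `sech² = 1 - tanh²` puts the velocity in this form. When `u` is orthogonal to `N`
and of the same length, it is `k` times the projection of `N` onto the tangent space of the sphere.
-/
theorem hasDerivAt_meridianFlow (c N u : V) (k t : ℝ) :
    HasDerivAt (meridianFlow c N u k) (k • (N - Real.tanh (k * t) •
      (meridianFlow c N u k t - c))) t := by
  have h1 : HasDerivAt (fun t : ℝ => k * t) k t := by
    simpa using (hasDerivAt_id t).const_mul k
  have h2 := (Real.hasDerivAt_tanh_inv_cosh (k * t)).comp t h1
  have h3 := (Real.hasDerivAt_inv_cosh (k * t)).comp t h1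
  have h4 := ((h2.smul_const N).add (h3.smul_const u)).const_add c
  have h5 : HasDerivAt (meridianFlow c N u k) _ t := h4
  convert h5 using 1
  have h6 : ((Real.cosh (k * t))⁻¹) ^ 2 = 1 - Real.tanh (k * t) ^ 2 := by
    linarith [Real.tanh_sq_add_inv_cosh_sq (k * t)]
  rw [h6, meridianFlow, add_sub_cancel_left]
  module

/-- The substitution `cos θ = tanh (k t)` is a bijection between `θ ∈ (0, π)` and `t ∈ ℝ`. -/
theorem range_meridianFlow (c N u : V) {k : ℝ} (hk : 0 < k) :
    Set.range (meridianFlow c N u k) = meridian c (c + N) u := by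
  rw [meridian]
  simp only [add_sub_cancel_left]
  ext x
  constructor
  · rintro ⟨t, rfl⟩
    have hs : Real.tanh (k * t) ∈ Set.Ioo (-1 : ℝ) 1 :=
      ⟨Real.neg_one_lt_tanh _, Real.tanh_lt_one _⟩
    refine ⟨Real.arccos (Real.tanh (k * t)), ⟨Real.arccos_pos.2 hs.2, ?_⟩, ?_⟩
    · refine lt_of_le_of_ne (Real.arccos_le_pi _) fun h => ?_
      exact absurd (Real.arccos_eq_pi.1 h) (not_le.2 hs.1)
    · simp only [Real.cos_arccos hs.1.le hs.2.le, Real.sin_arccos, meridianFlow,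
        Real.inv_cosh_eq_sqrt, add_assoc]
  · rintro ⟨θ, hθ, rfl⟩
    have hsin := Real.sin_pos_of_pos_of_lt_pi hθ.1 hθ.2
    have hcos : Real.cos θ ∈ Set.Ioo (-1 : ℝ) 1 := by
      have := Real.sin_sq_add_cos_sq θ
      constructor <;> nlinarith [sq_nonneg (Real.sin θ), pow_pos hsin 2]
    refine ⟨Real.artanh (Real.cos θ) / k, ?_⟩
    simp only [meridianFlow, mul_div_cancel₀ _ hk.ne', Real.inv_cosh_eq_sqrt,
      Real.tanh_artanh hcos, ← Real.abs_sin_eq_sqrt_one_sub_cos_sq, abs_of_pos hsin, add_assoc]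

/-- The cases `s = 1` and `s = -1` are the two ends of the meridian. -/
theorem tendsto_meridianFlow {l : Filter ℝ} {k s : ℝ} (hs : s ^ 2 = 1) (c N u : V)
    (h : Filter.Tendsto (fun t => Real.tanh (k * t)) l (𝓝 s)) :
    Filter.Tendsto (meridianFlow c N u k) l (𝓝 (c + s • N)) := by
  have h1 : Filter.Tendsto (fun t => (Real.cosh (k * t))⁻¹) l (𝓝 0) := by
    have h2 : Filter.Tendsto (fun t => √(1 - Real.tanh (k * t) ^ 2)) l (𝓝 √(1 - s ^ 2)) :=
      (tendsto_const_nhds.sub (h.pow 2)).sqrt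
    rw [hs, sub_self, Real.sqrt_zero] at h2
    exact h2.congr fun t => (Real.inv_cosh_eq_sqrt _).symm
  have h3 := tendsto_const_nhds (x := c) |>.add ((h.smul_const N).add (h1.smul_const u))
  rw [zero_smul, add_zero] at h3
  exact h3

end SubmanifoldGeom
end

noncomputable section

namespace QFlag

variable {n : ℕ}

/-! ### Matrices supported in a `2 × 2` block -/

/-- The matrix with block `(x, y; z, t)` in the rows and columns `p`, `q`, and with the scalar `e`
on the rest of the diagonal. -/
def blockMat (p q : Fin n) (e x y z t : ℍ[ℝ]) : Matrix (Fin n) (Fin n) ℍ[ℝ] :=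
  Matrix.of fun i j =>
    if i = p then (if j = p then x else if j = q then y else 0)
    else if i = q then (if j = p then z else if j = q then t else 0)
    else if i = j then e else 0

theorem blockMat_mul_apply {p q : Fin n} (hpq : p ≠ q) (e x y z t : ℍ[ℝ])
    (M : Matrix (Fin n) (Fin n) ℍ[ℝ]) (i j : Fin n) :
    (blockMat p q e x y z t * M) i j = if i = p then x * M p j + y * M q j
      else if i = q then z * M p j + t * M q j else e * M i j := by
  rw [Matrix.mul_apply]
  by_cases hp : i = p
  · rw [if_pos hp, Fintype.sum_eq_add p q hpq]
    · simp [blockMat, hp, hpq.symm]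
    · rintro k ⟨h1, h2⟩
      simp [blockMat, hp, h1, h2]
  by_cases hq : i = q
  · rw [if_neg hp, if_pos hq, Fintype.sum_eq_add p q hpq]
    · simp [blockMat, hq, hpq.symm]
    · rintro k ⟨h1, h2⟩
      simp [blockMat, hq, hpq.symm, h1, h2]
  · rw [if_neg hp, if_neg hq, Finset.sum_eq_single i]
    · simp [blockMat, hp, hq]
    · intro k _ hk
      simp [blockMat, hp, hq, Ne.symm hk]
    · simp

theorem blockMat_mul {p q : Fin n} (hpq : p ≠ q) (e x y z t e' x' y' z' t' : ℍ[ℝ]) :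
    blockMat p q e x y z t * blockMat p q e' x' y' z' t'
      = blockMat p q (e * e') (x * x' + y * z') (x * y' + y * t') (z * x' + t * z')
        (z * y' + t * t') := by
  ext1 i j
  rw [blockMat_mul_apply hpq]
  by_cases hp : i = p <;> by_cases hq : i = q <;> by_cases hp' : j = p <;>
    by_cases hq' : j = q <;> simp [blockMat, hp, hq, hp', hq', hpq.symm]

theorem star_blockMat {p q : Fin n} (hpq : p ≠ q) (e x y z t : ℍ[ℝ]) :
    star (blockMat p q e x y z t)
      = blockMat p q (star e) (star x) (star z) (star y) (star t) := by
  ext1 i j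
  rw [Matrix.star_apply]
  by_cases hp : i = p <;> by_cases hq : i = q <;> by_cases hp' : j = p <;>
    by_cases hq' : j = q <;> by_cases hij : i = j <;>
    simp_all [blockMat, eq_comm]

theorem blockMat_one {p q : Fin n} : blockMat p q 1 1 0 0 1 = 1 := by
  ext1 i j
  rw [Matrix.one_apply]
  by_cases hp : i = p <;> by_cases hq : i = q <;> by_cases hij : i = j <;>
    simp_all [blockMat, eq_comm]

/-- The trace-free Hermitian matrices supported in the block of `p` and `q`. -/
def blockSub (p q : Fin n) : Submodule ℝ (QHerm n) where
  carrier := {X | ∀ i j, ¬((i = p ∨ i = q) ∧ (j = p ∨ j = q)) → X.mat i j = 0}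
  add_mem' := by
    intro X Y hX hY i j h
    rw [QHerm.mat_add, Matrix.add_apply, hX i j h, hY i j h, add_zero]
  zero_mem' := by
    intro i j _
    simp
  smul_mem' := by
    intro c X hX i j h
    rw [QHerm.mat_smul, Matrix.smul_apply, hX i j h, smul_zero]

/-- The trace-free Hermitian matrix with the block `(x, z; z*, -x)`. -/
def blockPoint {p q : Fin n} (hpq : p ≠ q) (x : ℝ) (z : ℍ[ℝ]) : QHerm n :=
  ⟨blockMat p q 0 x z (star z) (-x), by
    refine ⟨?_, ?_⟩
    · change star _ = _
      rw [star_blockMat hpq]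
      simp
    · rw [Matrix.trace, Fintype.sum_eq_add p q hpq]
      · simp [blockMat, hpq.symm]
      · rintro k ⟨h1, h2⟩
        simp [blockMat, h1, h2]⟩

theorem blockPoint_mat {p q : Fin n} (hpq : p ≠ q) (x : ℝ) (z : ℍ[ℝ]) :
    (blockPoint hpq x z).mat = blockMat p q 0 x z (star z) (-x) := rfl

theorem blockPoint_mem {p q : Fin n} (hpq : p ≠ q) (x : ℝ) (z : ℍ[ℝ]) :
    blockPoint hpq x z ∈ blockSub p q := by
  intro i j h
  rw [blockPoint_mat]
  simp only [blockMat, Matrix.of_apply]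
  grind

theorem mat_qq_of_mem {p q : Fin n} (hpq : p ≠ q) {X : QHerm n} (hX : X ∈ blockSub p q) :
    X.mat q q = -X.mat p p := by
  have h := X.mat_trace
  rw [Matrix.trace, Fintype.sum_eq_add p q hpq] at h
  · exact eq_neg_of_add_eq_zero_right h
  · rintro k ⟨h1, h2⟩
    exact hX k k (by tauto)

theorem eq_blockPoint {p q : Fin n} (hpq : p ≠ q) {X : QHerm n} (hX : X ∈ blockSub p q) :
    X = blockPoint hpq (X.mat p p).re (X.mat p q) := by
  apply QHerm.ext_mat
  ext1 i j
  rw [blockPoint_mat]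
  simp only [blockMat, Matrix.of_apply]
  split_ifs with h1 h2 h3 h4 h5 h6 h7
  · rw [h1, h2]; exact mat_diag_eq_re X p
  · rw [h1, h3]
  · exact hX i j (by tauto)
  · rw [h4, h5, star_mat_apply]
  · rw [h4, h6, mat_qq_of_mem hpq hX]; exact congrArg Neg.neg (mat_diag_eq_re X p)
  · exact hX i j (by tauto)
  · exact hX i j (by tauto)
  · exact hX i j (by tauto)

/-- The coordinates are one real diagonal entry and one quaternion, so the dimension is `1 + 4`. -/
theorem finrank_blockSub {p q : Fin n} (hpq : p ≠ q) :
    Module.finrank ℝ (blockSub p q) = 5 := by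
  let e : blockSub p q ≃ₗ[ℝ] ℝ × ℍ[ℝ] :=
    { toFun := fun X => ((X.1.mat p p).re, X.1.mat p q)
      map_add' := fun _ _ => rfl
      map_smul' := fun _ _ => rfl
      invFun := fun v => ⟨blockPoint hpq v.1 v.2, blockPoint_mem hpq v.1 v.2⟩
      left_inv := fun X => Subtype.ext (eq_blockPoint hpq X.2).symm
      right_inv := fun v => by
        simp [blockPoint_mat, blockMat, hpq.symm] }
  rw [e.finrank_eq, Module.finrank_prod, Quaternion.finrank_eq_four, Module.finrank_self]

theorem inner_blockPoint {p q : Fin n} (hpq : p ≠ q) (x : ℝ) (z : ℍ[ℝ]) (X : QHerm n) :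
    inner ℝ (blockPoint hpq x z) X
      = x * ((X.mat p p).re - (X.mat q q).re) + 2 * inner ℝ z (X.mat p q) := by
  rw [inner_def, blockPoint_mat, Matrix.trace, Fintype.sum_eq_add p q hpq]
  · simp only [Matrix.diag, blockMat_mul_apply hpq, if_true, if_neg hpq.symm]
    rw [← star_mat_apply X p q, Quaternion.inner_def]
    have h : (star z * X.mat p q).re = (z * star (X.mat p q)).re := by
      rw [← Quaternion.re_star, star_mul, star_star, quat_re_mul_comm]
    simp only [Quaternion.re_add, h, neg_mul, Quaternion.re_neg, Quaternion.coe_mul_eq_smul,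
      Quaternion.re_smul, smul_eq_mul]
    ring
  · rintro k ⟨h1, h2⟩
    simp [Matrix.diag, blockMat_mul_apply hpq, h1, h2]

theorem norm_blockPoint_sq {p q : Fin n} (hpq : p ≠ q) (x : ℝ) (z : ℍ[ℝ]) :
    ‖blockPoint hpq x z‖ ^ 2 = 2 * (x ^ 2 + ‖z‖ ^ 2) := by
  rw [← real_inner_self_eq_norm_sq, inner_blockPoint, ← real_inner_self_eq_norm_sq z,
    blockPoint_mat]
  simp [blockMat, hpq.symm]
  ring

/-- Real diagonal matrices with equal entries at `p` and `q` commute with the block matrices. -/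
theorem diagonal_comm_of_mem_blockSub {p q : Fin n} {e : Fin n → ℝ} (he : e p = e q)
    {Z : QHerm n} (hZ : Z ∈ blockSub p q) :
    (Matrix.diagonal fun i => (e i : ℍ[ℝ])) * Z.mat
      = Z.mat * Matrix.diagonal fun i => (e i : ℍ[ℝ]) := by
  ext1 i j
  rw [Matrix.mul_diagonal, Matrix.diagonal_mul]
  by_cases h : (i = p ∨ i = q) ∧ (j = p ∨ j = q)
  · have : e i = e j := by
      rcases h with ⟨rfl | rfl, rfl | rfl⟩ <;> simp [he]
    rw [this, Quaternion.coe_commutes]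
  · rw [hZ i j h, mul_zero, zero_mul]

/-- A real diagonal matrix with equal entries at `p` and `q` is scalar on each block of `K_pq`,
hence centralized by it. The centre of the sphere is such a matrix. -/
theorem smul_eq_self_of_mem_Kpq {p q : Fin n} {e : Fin n → ℝ} (he : e p = e q) {C : QHerm n}
    (hC : C.mat = Matrix.diagonal fun i => (e i : ℍ[ℝ])) {g : Sp n} (hg : g ∈ Kpq p q) :
    g • C = C := by
  have hcomm : g.1 * C.mat = C.mat * g.1 := by
    rw [hC]
    ext1 i j
    rw [Matrix.mul_diagonal, Matrix.diagonal_mul]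
    by_cases hij : i = j
    · rw [hij, Quaternion.coe_commutes]
    by_cases h1 : i = p ∧ j = q
    · rw [h1.1, h1.2, he, Quaternion.coe_commutes]
    by_cases h2 : i = q ∧ j = p
    · rw [h2.1, h2.2, he, Quaternion.coe_commutes]
    · have h0 : g.1 i j = 0 := hg i j hij h1 h2
      rw [h0, mul_zero, zero_mul]
  apply QHerm.ext_mat
  rw [mat_smul_action, hcomm, mul_assoc, Unitary.mul_star_self_of_mem g.2, mul_one]

theorem smul_mem_blockSub {p q : Fin n} {g : Sp n} (hg : g ∈ Kpq p q) {Z : QHerm n}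
    (hZ : Z ∈ blockSub p q) : g • Z ∈ blockSub p q := by
  have hrow : ∀ i k, ¬(i = p ∨ i = q) → (k = p ∨ k = q) → g.1 i k = 0 := fun i k hi hk =>
    hg i k (by rintro rfl; exact hi hk) (by tauto) (by tauto)
  intro i j hij
  rw [mat_smul_action, Matrix.mul_apply]
  refine Finset.sum_eq_zero fun k _ => ?_
  rw [Matrix.mul_apply, Finset.sum_mul]
  refine Finset.sum_eq_zero fun l _ => ?_
  rw [Matrix.star_apply]
  by_cases h : (l = p ∨ l = q) ∧ (k = p ∨ k = q)
  · by_cases hi : i = p ∨ i = q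
    · rw [hrow j k (by tauto) h.2, star_zero, mul_zero]
    · rw [hrow i l hi h.1, zero_mul, zero_mul]
  · rw [hZ l k h, mul_zero, zero_mul]

/-- This is surjectivity of a Hopf map, restricted to real `α`. As for half angles, `α² = (1 +
x/δ)/2`, and then `β = z/(2δα)` is forced. -/
theorem exists_rotation (x δ : ℝ) (hδ : δ ≠ 0) (z : ℍ[ℝ]) (h : x ^ 2 + ‖z‖ ^ 2 = δ ^ 2) :
    ∃ (α : ℝ) (β : ℍ[ℝ]), α ^ 2 + ‖β‖ ^ 2 = 1 ∧ x = δ * (α ^ 2 - ‖β‖ ^ 2) ∧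
      z = (2 * δ * α) • β := by
  have h1 : (x / δ) ^ 2 + (‖z‖ / δ) ^ 2 = 1 := by
    rw [div_pow, div_pow, ← add_div, h, div_self (pow_ne_zero 2 hδ)]
  -- At the antipode of the pole the half-angle formula gives `α = 0` and cannot divide; there `z =
  -- 0` and any unit `β` works.
  by_cases hx : x / δ = -1
  · refine ⟨0, 1, by simp, ?_, ?_⟩
    · rw [div_eq_iff hδ] at hx
      rw [hx]
      simp
    · rw [hx] at h1
      have h2 : (‖z‖ / δ) ^ 2 = 0 := by linarith
      have h3 : ‖z‖ = 0 := by simpa [hδ] using h2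
      rw [norm_eq_zero.1 h3]
      simp
  · have hge : -1 ≤ x / δ := by nlinarith [sq_nonneg (‖z‖ / δ)]
    have hpos : 0 < (1 + x / δ) / 2 := by
      have : -1 < x / δ := lt_of_le_of_ne hge (Ne.symm hx)
      linarith
    set α := √((1 + x / δ) / 2) with hα
    have hαpos : 0 < α := Real.sqrt_pos.2 hpos
    have hα2 : α ^ 2 = (1 + x / δ) / 2 := Real.sq_sqrt hpos.le
    have hβ : ‖(2 * δ * α)⁻¹ • z‖ ^ 2 = (1 - x / δ) / 2 := by
      rw [norm_smul, mul_pow, Real.norm_eq_abs, sq_abs, inv_pow, mul_pow, mul_pow, hα2]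
      have h2 : ‖z‖ ^ 2 = δ ^ 2 * (1 - x / δ) * (1 + x / δ) := by
        have : (‖z‖ / δ) ^ 2 = 1 - (x / δ) ^ 2 := by linarith
        rw [div_pow, div_eq_iff (pow_ne_zero 2 hδ)] at this
        rw [this]
        ring
      have h3 : (1 + x / δ) ≠ 0 := by linarith
      rw [h2]
      generalize x / δ = y at *
      field_simp
    refine ⟨α, (2 * δ * α)⁻¹ • z, ?_, ?_, ?_⟩
    · rw [hα2, hβ]; ring
    · rw [hα2, hβ]
      linear_combination -(mul_div_cancel₀ x hδ)
    · rw [smul_smul, mul_inv_cancel₀ (mul_ne_zero (mul_ne_zero two_ne_zero hδ) hαpos.ne'),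
        one_smul]

/-- This is transitivity of `K_pq` on the sphere. The block `(α, -β; β*, α)`, with `α` real,
conjugates `(δ, 0; 0, -δ)` to the block with diagonal `±δ(α² - |β|²)` and upper corner `2δαβ`. -/
theorem exists_mem_Kpq_smul {p q : Fin n} (hpq : p ≠ q) {δ x : ℝ} (hδ : δ ≠ 0) {z : ℍ[ℝ]}
    (h : x ^ 2 + ‖z‖ ^ 2 = δ ^ 2) :
    ∃ g ∈ Kpq p q, g • blockPoint hpq δ 0 = blockPoint hpq x z := by
  obtain ⟨α, β, h1, hx, hz⟩ := exists_rotation x δ hδ z h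
  have hn : ∀ β : ℍ[ℝ], β * star β = ((‖β‖ ^ 2 : ℝ) : ℍ[ℝ]) := fun β => by
    rw [Quaternion.self_mul_star, Quaternion.normSq_eq_norm_mul_self, sq]
  have hn' : ∀ β : ℍ[ℝ], star β * β = ((‖β‖ ^ 2 : ℝ) : ℍ[ℝ]) := fun β => by
    rw [Quaternion.star_mul_self, Quaternion.normSq_eq_norm_mul_self, sq]
  have hc : ∀ β : ℍ[ℝ], (α : ℍ[ℝ]) * β = β * α := fun β => Quaternion.coe_commutes α β
  have hone : ∀ β : ℍ[ℝ], α ^ 2 + ‖β‖ ^ 2 = 1 →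
      blockMat p q 1 α (-β) (star β) α * blockMat p q 1 α β (-star β) α = 1 := by
    intro β hβ
    rw [blockMat_mul hpq, ← blockMat_one]
    have h2 : (α : ℍ[ℝ]) * α + ((‖β‖ ^ 2 : ℝ) : ℍ[ℝ]) = 1 := by
      rw [← Quaternion.coe_mul, ← Quaternion.coe_add, ← sq, hβ, Quaternion.coe_one]
    congr 1
    · rw [mul_one]
    · rw [neg_mul_neg, hn, h2]
    · rw [hc, neg_mul, add_neg_cancel]
    · rw [mul_neg, hc, add_neg_cancel]
    · rw [hn', add_comm, h2]
  have hstar : star (blockMat p q 1 α (-β) (star β) α) = blockMat p q 1 α β (-star β) α := by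
    rw [star_blockMat hpq]
    simp
  have hg1 := hone β h1
  -- Replacing `β` by `-β` exchanges the matrix and its adjoint, so the other product needs no new
  -- computation.
  have hg2 : blockMat p q 1 α β (-star β) α * blockMat p q 1 α (-β) (star β) α = 1 := by
    have := hone (-β) (by rwa [norm_neg])
    simpa using this
  refine ⟨⟨blockMat p q 1 α (-β) (star β) α, Unitary.mem_iff.2 ⟨by rwa [hstar], by rwa [hstar]⟩⟩,
    ?_, ?_⟩
  · intro i j hij h2 h3
    change blockMat p q 1 α (-β) (star β) α i j = 0
    simp only [blockMat, Matrix.of_apply]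
    grind
  · apply QHerm.ext_mat
    change blockMat p q 1 α (-β) (star β) α * (blockPoint hpq δ 0).mat
      * star (blockMat p q 1 α (-β) (star β) α) = _
    rw [hstar, blockPoint_mat, blockPoint_mat, blockMat_mul hpq, blockMat_mul hpq]
    have hb : ‖β‖ ^ 2 = β.re * β.re + β.imI * β.imI + β.imJ * β.imJ + β.imK * β.imK := by
      rw [sq, ← Quaternion.normSq_eq_norm_mul_self, Quaternion.normSq_def']
      ring
    rw [hb, sq α] at hx
    subst hx hz
    congr 1
    · simp
    all_goals ext <;> simp <;> ring

end QFlag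
end

noncomputable section

namespace QFlag

variable {n : ℕ}

/-! ### The orbits of the block subgroups are round spheres -/

/-- The vector from the centre of the sphere `K_{pq}.Diag(d)` to its point `Diag(d)`. -/
def poleVec {p q : Fin n} (hpq : p ≠ q) (d : Fin n → ℝ) : QHerm n :=
  blockPoint hpq ((d p - d q) / 2) 0

theorem poleVec_mem {p q : Fin n} (hpq : p ≠ q) (d : Fin n → ℝ) :
    poleVec hpq d ∈ blockSub p q := blockPoint_mem hpq _ _

theorem inner_poleVec {p q : Fin n} (hpq : p ≠ q) (d : Fin n → ℝ) {Y : QHerm n}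
    (hY : Y ∈ blockSub p q) : inner ℝ (poleVec hpq d) Y = (d p - d q) * (Y.mat p p).re := by
  rw [poleVec, inner_blockPoint, mat_qq_of_mem hpq hY, Quaternion.re_neg, inner_zero_left]
  ring

theorem inner_diagPoint_of_mem_blockSub {p q : Fin n} (hpq : p ≠ q) (a : Fin n → ℝ)
    (ha : ∑ i, a i = 0) {Y : QHerm n} (hY : Y ∈ blockSub p q) :
    inner ℝ (diagPoint a ha) Y = (a p - a q) * (Y.mat p p).re := by
  rw [inner_diagPoint, Fintype.sum_eq_add p q hpq]
  · rw [mat_qq_of_mem hpq hY, Quaternion.re_neg]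
    ring
  · rintro k ⟨h1, h2⟩
    rw [hY k k (by tauto)]
    simp

/-- Subtracting the right multiple of the pole vector averages the entries at `p` and `q`. It is
used with `k = 1` for the centre, with `k = -1` for the swapped point, and with `k = (a p - a q)/(d
p - d q)` for `A`. -/
theorem diagPoint_sub_smul_poleVec {p q : Fin n} (hpq : p ≠ q) (a d : Fin n → ℝ)
    (ha : ∑ i, a i = 0) {k : ℝ} (hk : k * (d p - d q) = a p - a q) :
    (diagPoint a ha - k • poleVec hpq d).mat
      = Matrix.diagonal fun i => ((if i = p ∨ i = q then (a p + a q) / 2 else a i : ℝ) : ℍ[ℝ]) := by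
  ext1 i j
  have h1 : a p - k * ((d p - d q) / 2) = (a p + a q) / 2 := by linarith
  have h2 : a q + k * ((d p - d q) / 2) = (a p + a q) / 2 := by linarith
  rw [mat_sub, QHerm.mat_smul, Matrix.sub_apply, Matrix.smul_apply, poleVec, blockPoint_mat,
    diagPoint_mat, star_zero]
  by_cases hij : i = j
  · subst hij
    rw [Matrix.diagonal_apply_eq, Matrix.diagonal_apply_eq]
    by_cases hp : i = p
    · subst hp
      simp only [blockMat, Matrix.of_apply, if_true, true_or]
      rw [← h1, ← Quaternion.coe_mul_eq_smul, ← Quaternion.coe_mul, ← Quaternion.coe_sub]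
    by_cases hq : i = q
    · subst hq
      simp only [blockMat, Matrix.of_apply, if_true, or_true, if_neg hp]
      rw [← h2, smul_neg, sub_neg_eq_add, ← Quaternion.coe_mul_eq_smul, ← Quaternion.coe_mul,
        ← Quaternion.coe_add]
    · simp [blockMat, hp, hq]
  · rw [Matrix.diagonal_apply_ne _ hij, Matrix.diagonal_apply_ne _ hij]
    have : blockMat p q 0 (((d p - d q) / 2 : ℝ) : ℍ[ℝ]) 0 0 (-(((d p - d q) / 2 : ℝ) : ℍ[ℝ])) i j
        = 0 := by
      simp only [blockMat, Matrix.of_apply]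
      grind
    rw [this, smul_zero, sub_zero]

theorem center_mat {p q : Fin n} (hpq : p ≠ q) (d : Fin n → ℝ) (hd : ∑ i, d i = 0) :
    (diagPoint d hd - poleVec hpq d).mat
      = Matrix.diagonal fun i => ((if i = p ∨ i = q then (d p + d q) / 2 else d i : ℝ) : ℍ[ℝ]) := by
  have := diagPoint_sub_smul_poleVec hpq d d hd (one_mul _)
  rwa [one_smul] at this

theorem poleVec_ne_zero {p q : Fin n} (hpq : p ≠ q) {d : Fin n → ℝ} (hd : d p ≠ d q) :
    poleVec hpq d ≠ 0 := by
  intro h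
  have h1 := norm_blockPoint_sq hpq ((d p - d q) / 2) 0
  rw [poleVec] at h
  rw [h, norm_zero, norm_zero] at h1
  have h2 : ((d p - d q) / 2) ^ 2 = 0 := by linarith
  have h3 : (d p - d q) / 2 = 0 := by simpa using h2
  exact hd (by linarith)

/-- The group `K_pq` fixes the centre `c`, preserves the block space and acts isometrically, so the
orbit lies on the sphere; transitivity on blocks of given norm fills it. -/
theorem orbit_Kpq_eq_roundSphere {p q : Fin n} (hpq : p ≠ q) {d : Fin n → ℝ}
    (hd : ∑ i, d i = 0) (hdpq : d p ≠ d q) :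
    MulAction.orbit (Kpq p q) (diagPoint d hd)
      = roundSphere (diagPoint d hd - poleVec hpq d) (blockSub p q) ‖poleVec hpq d‖ := by
  set c := diagPoint d hd - poleVec hpq d with hc
  have hD : diagPoint d hd = c + poleVec hpq d := (sub_add_cancel _ _).symm
  have hfix : ∀ g : Sp n, g ∈ Kpq p q → g • c = c := fun g hg =>
    smul_eq_self_of_mem_Kpq (by simp) (center_mat hpq d hd) hg
  ext X
  constructor
  · rintro ⟨⟨g, hg⟩, rfl⟩
    change g • diagPoint d hd - c ∈ blockSub p q ∧ ‖g • diagPoint d hd - c‖ = _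
    rw [hD, smul_add_action, hfix g hg, add_sub_cancel_left]
    refine ⟨smul_mem_blockSub hg (poleVec_mem hpq d), ?_⟩
    rw [@norm_eq_sqrt_real_inner (QHerm n), inner_smul_smul_action,
      ← @norm_eq_sqrt_real_inner (QHerm n)]
  · rintro ⟨hX, hXn⟩
    have hδ : (d p - d q) / 2 ≠ 0 := div_ne_zero (sub_ne_zero.2 hdpq) two_ne_zero
    have h1 := congrArg (· ^ 2) hXn
    rw [eq_blockPoint hpq hX, poleVec, norm_blockPoint_sq, norm_blockPoint_sq, norm_zero] at h1
    obtain ⟨g, hg, hgX⟩ := exists_mem_Kpq_smul hpq hδ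
      (x := ((X - c).mat p p).re) (z := (X - c).mat p q) (by linarith)
    refine ⟨⟨g, hg⟩, ?_⟩
    change g • diagPoint d hd = X
    rw [hD, smul_add_action, hfix g hg, poleVec, hgX, ← eq_blockPoint hpq hX, add_sub_cancel]

/-- Averaging the entries at `p` and `q` gives the same centre for both points, with opposite pole
vectors; hence they are antipodal. -/
theorem swap_eq_center_sub {p q : Fin n} (hpq : p ≠ q) (d : Fin n → ℝ) (hd : ∑ i, d i = 0)
    (hd' : ∑ i, d (Equiv.swap p q i) = 0) :
    diagPoint (fun i => d (Equiv.swap p q i)) hd'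
      = diagPoint d hd - poleVec hpq d - poleVec hpq d := by
  have h := diagPoint_sub_smul_poleVec hpq (fun i => d (Equiv.swap p q i)) d hd' (k := -1)
    (by simp)
  rw [neg_one_smul, sub_neg_eq_add] at h
  rw [eq_sub_iff_add_eq]
  apply QHerm.ext_mat
  rw [h, center_mat]
  congr 1
  funext i
  by_cases hi : i = p ∨ i = q
  · simp [hi, add_comm]
  · push Not at hi
    simp [hi.1, hi.2, Equiv.swap_apply_of_ne_of_ne hi.1 hi.2]

/-- With `Z = X - c`, `A - G = (A - kN) + k s Z`. Both `A - kN` and `c` are diagonal with equal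
entries at `p, q`, so they commute with `Z` and with each other. Thus `A - G` commutes with `X = c +
Z` and is normal, and tangency of `G` makes it the gradient. -/
theorem isGradientAt_of_mem_sphere {p q : Fin n} (hpq : p ≠ q) {d : Fin n → ℝ}
    (hdi : Function.Injective d) (hd : ∑ i, d i = 0) (a : Fin n → ℝ) (ha : ∑ i, a i = 0)
    {X : QHerm n} (hX : X ∈ MulAction.orbit (Sp n) (diagPoint d hd))
    (hXE : X - (diagPoint d hd - poleVec hpq d) ∈ blockSub p q) {k s : ℝ}
    (hk : k * (d p - d q) = a p - a q) {G : QHerm n}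
    (hG : G = k • (poleVec hpq d - s • (X - (diagPoint d hd - poleVec hpq d))))
    (hGt : G ∈ tangentSpaceOf (MulAction.orbit (Sp n) (diagPoint d hd)) X) :
    IsGradientAt (MulAction.orbit (Sp n) (diagPoint d hd)) (height a ha) X G := by
  refine ⟨hGt, fun γ hγ => ?_⟩
  have h := hasDerivAt_height hγ.hasDerivAt a ha
  set c := diagPoint d hd - poleVec hpq d with hc
  have hcomm : (diagPoint a ha - G).mat * X.mat = X.mat * (diagPoint a ha - G).mat := by
    obtain ⟨Z, hZ⟩ : ∃ Z, Z = X - c := ⟨_, rfl⟩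
    have hXZ : X = c + Z := by rw [hZ, add_sub_cancel]
    have hA : diagPoint a ha - G = (diagPoint a ha - k • poleVec hpq d) + (k * s) • Z := by
      rw [hG, hZ]
      module
    rw [← hZ] at hXE
    have h1 := diagonal_comm_of_mem_blockSub (p := p) (q := q)
      (e := fun i => if i = p ∨ i = q then (a p + a q) / 2 else a i) (by simp) hXE
    have h2 := diagonal_comm_of_mem_blockSub (p := p) (q := q)
      (e := fun i => if i = p ∨ i = q then (d p + d q) / 2 else d i) (by simp) hXE
    rw [← diagPoint_sub_smul_poleVec hpq a d ha hk] at h1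
    rw [← center_mat hpq d hd, ← hc] at h2
    have h3 : (diagPoint a ha - k • poleVec hpq d).mat * c.mat
        = c.mat * (diagPoint a ha - k • poleVec hpq d).mat := by
      rw [diagPoint_sub_smul_poleVec hpq a d ha hk, hc, center_mat,
        Matrix.diagonal_mul_diagonal, Matrix.diagonal_mul_diagonal]
      congr 1
      funext i
      exact Quaternion.coe_commutes _ _
    rw [hA, hXZ, QHerm.mat_add, QHerm.mat_add, QHerm.mat_smul]
    simp only [add_mul, mul_add, smul_mul_assoc, mul_smul_comm, smul_add]
    rw [h1, h3, h2]
    abel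
  have hz := inner_deriv_eq_zero_of_commute hdi hd hX hcomm hγ
  rw [inner_sub_left, sub_eq_zero] at hz
  rwa [hz] at h

theorem isGradientLine_meridian {p q : Fin n} (hpq : p ≠ q) {d : Fin n → ℝ}
    (hdi : Function.Injective d) (hd : ∑ i, d i = 0) (a : Fin n → ℝ) (ha : ∑ i, a i = 0)
    (hpos : 0 < (a p - a q) * (d p - d q)) {u : QHerm n} (hu : u ∈ blockSub p q)
    (hun : ‖u‖ = ‖poleVec hpq d‖) (huN : inner ℝ u (poleVec hpq d) = 0) :
    IsGradientLine (MulAction.orbit (Sp n) (diagPoint d hd)) (height a ha)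
      (meridian (diagPoint d hd - poleVec hpq d) (diagPoint d hd) u)
      (diagPoint d hd - poleVec hpq d - poleVec hpq d) (diagPoint d hd) := by
  set N := poleVec hpq d with hN
  set c := diagPoint d hd - N with hc
  have hdpq : d p - d q ≠ 0 := fun h => by rw [h, mul_zero] at hpos; exact hpos.false
  -- This `k` makes `A - kN` equal at `p` and `q`; its positivity makes the flow run towards
  -- `Diag(d)`.
  set k := (a p - a q) / (d p - d q) with hkdef
  have hk : k * (d p - d q) = a p - a q := div_mul_cancel₀ _ hdpq
  have hkpos : 0 < k := by
    have : 0 < k * (d p - d q) ^ 2 := by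
      rw [sq, ← mul_assoc, hk]
      exact hpos
    exact pos_of_mul_pos_left this (sq_nonneg _)
  have hDc : diagPoint d hd = c + N := (sub_add_cancel _ _).symm
  have hE : ∀ t, meridianFlow c N u k t - c ∈ blockSub p q := fun t => by
    rw [meridianFlow, add_sub_cancel_left]
    exact Submodule.add_mem _ (Submodule.smul_mem _ _ (poleVec_mem hpq d))
      (Submodule.smul_mem _ _ hu)
  have hM : ∀ t, meridianFlow c N u k t ∈ MulAction.orbit (Sp n) (diagPoint d hd) := by
    intro t
    have h1 : meridianFlow c N u k t ∈ MulAction.orbit (Kpq p q) (diagPoint d hd) := by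
      rw [orbit_Kpq_eq_roundSphere hpq hd (sub_ne_zero.1 hdpq)]
      refine ⟨hE t, ?_⟩
      rw [← hN, ← hc, meridianFlow, add_sub_cancel_left]
      exact norm_add_smul_of_orthogonal hun huN (Real.tanh_sq_add_inv_cosh_sq _)
    obtain ⟨g, hg⟩ := h1
    exact ⟨g.1, hg⟩
  have hder := hasDerivAt_meridianFlow c N u k
  refine ⟨meridianFlow c N u k, ?_, ?_, fun t => ⟨_, ?_, hder t⟩, ?_, ?_⟩
  · rw [range_meridianFlow c N u hkpos, ← hDc]
  · rw [hDc, ← range_meridianFlow c N u hkpos]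
    rintro _ ⟨t, rfl⟩
    rw [← hDc]
    exact hM t
  · refine isGradientAt_of_mem_sphere hpq hdi hd a ha (hM t) (hE t) hk rfl ?_
    -- Tangency comes for free: `G` is the velocity of the flow, which stays in the orbit.
    refine Submodule.subset_span ⟨fun τ => meridianFlow c N u k (t + τ),
      ⟨by simp, 1, one_pos, ?_, fun τ _ => hM _⟩, ?_⟩
    · exact ((contDiff_meridianFlow c N u k).comp
        (contDiff_const.add contDiff_id)).contDiffOn
    · have h1 := hder (t + 0)
      rw [add_zero] at h1
      exact (HasDerivAt.comp_const_add t 0 (by rw [add_zero]; exact h1)).deriv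
  · have h1 : Filter.Tendsto (fun t => Real.tanh (k * t)) Filter.atBot (𝓝 (-1)) :=
      Real.tendsto_tanh_atBot_neg_one.comp (Filter.tendsto_id.const_mul_atBot hkpos)
    have := tendsto_meridianFlow (by norm_num) c N u h1
    rwa [neg_one_smul, ← sub_eq_add_neg] at this
  · have h1 : Filter.Tendsto (fun t => Real.tanh (k * t)) Filter.atTop (𝓝 1) :=
      Real.tendsto_tanh_atTop_one.comp (Filter.tendsto_id.const_mul_atTop hkpos)
    have := tendsto_meridianFlow (by norm_num) c N u h1
    rwa [one_smul, ← hDc] at this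

/-- On the block space `⟨A, ·⟩ = k ⟨N, ·⟩` with `k > 0`, so on the sphere the height is an
increasing affine function of `⟨N, ·⟩`. The lowest point is obtained by applying the maximum
statement to `-Y`. -/
theorem height_lt_of_mem_sphere {p q : Fin n} (hpq : p ≠ q) {d : Fin n → ℝ}
    (hd : ∑ i, d i = 0) (a : Fin n → ℝ) (ha : ∑ i, a i = 0)
    (hpos : 0 < (a p - a q) * (d p - d q)) {X : QHerm n}
    (hX : X ∈ roundSphere (diagPoint d hd - poleVec hpq d) (blockSub p q) ‖poleVec hpq d‖) :
    (X ≠ diagPoint d hd → height a ha X < height a ha (diagPoint d hd)) ∧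
    (X ≠ diagPoint d hd - poleVec hpq d - poleVec hpq d →
      height a ha (diagPoint d hd - poleVec hpq d - poleVec hpq d) < height a ha X) := by
  set N := poleVec hpq d with hN
  set c := diagPoint d hd - N with hc
  have hDc : diagPoint d hd = c + N := (sub_add_cancel _ _).symm
  have hdpq : d p - d q ≠ 0 := fun h => by rw [h, mul_zero] at hpos; exact hpos.false
  obtain ⟨hXE, hXn⟩ := hX
  obtain ⟨Y, hY⟩ : ∃ Y, Y = X - c := ⟨_, rfl⟩
  have hXY : X = c + Y := by rw [hY, add_sub_cancel]
  rw [← hY] at hXE hXn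
  set k := (a p - a q) / (d p - d q) with hkdef
  have hk : k * (d p - d q) = a p - a q := div_mul_cancel₀ _ hdpq
  have hkpos : 0 < k := by
    have : 0 < k * (d p - d q) ^ 2 := by
      rw [sq, ← mul_assoc, hk]
      exact hpos
    exact pos_of_mul_pos_left this (sq_nonneg _)
  have hh : ∀ Z ∈ blockSub p q, inner ℝ (diagPoint a ha) Z = k * inner ℝ N Z := by
    intro Z hZ
    rw [inner_diagPoint_of_mem_blockSub hpq a ha hZ, hN, inner_poleVec hpq d hZ, ← hk, mul_assoc]
  have hNE : N ∈ blockSub p q := poleVec_mem hpq d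
  constructor
  · intro hne
    have h1 : inner ℝ N Y < inner ℝ N N :=
      inner_lt_of_mem_sphere hXn fun h => hne (by rw [hXY, h, hDc])
    rw [hDc, hXY, height, height, inner_add_right, inner_add_right, hh Y hXE, hh N hNE]
    linarith [mul_lt_mul_of_pos_left h1 hkpos]
  · intro hne
    have h1 : inner ℝ N (-Y) < inner ℝ N N :=
      inner_lt_of_mem_sphere (by rw [norm_neg, hXn]) fun h =>
        hne (by rw [hXY, ← h, sub_neg_eq_add])
    rw [hXY, height, height, inner_sub_right, inner_add_right, hh Y hXE, hh N hNE]
    rw [inner_neg_right] at h1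
    linarith [mul_lt_mul_of_pos_left h1 hkpos]

/-! ### The negative space of the Hessian -/

/-- The trace-free Hermitian matrices whose only nonzero entries are in the positions `pq`, `qp`. -/
def pairSub (p q : Fin n) : Submodule ℝ (QHerm n) where
  carrier := {X | ∀ i j, ¬((i = p ∧ j = q) ∨ (i = q ∧ j = p)) → X.mat i j = 0}
  add_mem' := by
    intro X Y hX hY i j h
    rw [QHerm.mat_add, Matrix.add_apply, hX i j h, hY i j h, add_zero]
  zero_mem' := by
    intro i j _
    simp
  smul_mem' := by
    intro c X hX i j h
    rw [QHerm.mat_smul, Matrix.smul_apply, hX i j h, smul_zero]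

/-- Within the block space, orthogonality to the pole vector means that the diagonal vanishes. -/
theorem tangentSpaceOf_orbit_Kpq {p q : Fin n} (hpq : p ≠ q) {d : Fin n → ℝ}
    (hd : ∑ i, d i = 0) (hdpq : d p ≠ d q) :
    tangentSpaceOf (MulAction.orbit (Kpq p q) (diagPoint d hd)) (diagPoint d hd)
      = pairSub p q := by
  ext Y
  have h := tangentSpaceOf_roundSphere (c := diagPoint d hd - poleVec hpq d)
    (poleVec_mem hpq d) (poleVec_ne_zero hpq hdpq) Y
  rw [sub_add_cancel, ← orbit_Kpq_eq_roundSphere hpq hd hdpq] at h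
  rw [h]
  constructor
  · rintro ⟨hY, hN⟩
    rw [inner_poleVec hpq d hY, mul_eq_zero] at hN
    have h1 : Y.mat p p = 0 := by
      rw [mat_diag_eq_re, hN.resolve_left (sub_ne_zero.2 hdpq), Quaternion.coe_zero]
    intro i j hij
    by_cases hb : (i = p ∨ i = q) ∧ (j = p ∨ j = q)
    · rcases hb with ⟨rfl | rfl, rfl | rfl⟩
      · exact h1
      · exact absurd (Or.inl ⟨rfl, rfl⟩) hij
      · exact absurd (Or.inr ⟨rfl, rfl⟩) hij
      · rw [mat_qq_of_mem hpq hY, h1, neg_zero]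
    · exact hY i j hb
  · intro hY
    have hYb : Y ∈ blockSub p q := fun i j hij => hY i j (by tauto)
    refine ⟨hYb, ?_⟩
    rw [inner_poleVec hpq d hYb, hY p p (by rintro (⟨-, h⟩ | ⟨h, -⟩) <;> exact hpq h)]
    simp

theorem pairSub_le_offDiagSub {p q : Fin n} (hpq : p ≠ q) : pairSub p q ≤ offDiagSub n :=
  fun Y hY i => hY i i (by rintro (⟨rfl, h⟩ | ⟨rfl, h⟩); exacts [hpq h, hpq h.symm])

/-- The entry at `pq` vanishes on every other summand but determines an element of its own. The
ordering `p < q` is needed because `pairSub p q = pairSub q p`. -/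
theorem iSupIndep_pairSub (I : Set (Fin n × Fin n)) (hI : ∀ i ∈ I, i.1 < i.2) :
    iSupIndep fun i : I => pairSub i.1.1 i.1.2 := by
  rintro ⟨⟨p, q⟩, hi⟩
  have hpq : p < q := hI _ hi
  rw [Submodule.disjoint_def]
  intro Y hY hY'
  let K : Submodule ℝ (QHerm n) :=
    LinearMap.ker ((entryL p q).comp (matL n)).toLinearMap
  have hle : (⨆ (j : I) (_ : j ≠ ⟨(p, q), hi⟩), pairSub j.1.1 j.1.2) ≤ K := by
    refine iSup₂_le ?_
    rintro ⟨⟨k, l⟩, hj⟩ hne Z hZ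
    have hkl : k < l := hI _ hj
    refine hZ p q ?_
    rintro (⟨rfl, rfl⟩ | ⟨rfl, rfl⟩)
    · exact hne rfl
    · exact absurd hkl hpq.not_gt
  have h1 : Y.mat p q = 0 := hle hY'
  apply QHerm.ext_mat
  ext1 i j
  rw [mat_zero, Matrix.zero_apply]
  by_cases h : (i = p ∧ j = q) ∨ (i = q ∧ j = p)
  · rcases h with ⟨rfl, rfl⟩ | ⟨rfl, rfl⟩
    · exact h1
    · rw [← star_mat_apply, h1, star_zero]
  · exact hY i j h

theorem hessForm_symm_coeff (a d : Fin n → ℝ) (i j : Fin n) :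
    (a i - a j) / (d j - d i) = (a j - a i) / (d i - d j) := by
  rw [← neg_sub (a j), ← neg_sub (d i), neg_div_neg_eq]

/-- With `λ_ij = (a i - a j)/(d j - d i)`, test the eigenvector equation on `Z_ij = (λ_ij - μ)
Y_ij`, which is Hermitian because `λ` is symmetric. The result is a vanishing sum of squares `((λ_ij
- μ) |Y_ij|)²`. The case `μ = 0` gives non-degeneracy. -/
theorem eq_of_hessForm_eq {a d : Fin n → ℝ} {μ : ℝ} {Y : QHerm n} (hY : Y ∈ offDiagSub n)
    (h : ∀ Z ∈ offDiagSub n, hessForm a d Y Z = μ * inner ℝ Y Z) {i j : Fin n}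
    (hij : Y.mat i j ≠ 0) : (a i - a j) / (d j - d i) = μ := by
  let Z := offDiagOf (Matrix.of fun k l => ((a k - a l) / (d l - d k) - μ) • Y.mat k l) (by
    intro k l _
    rw [Matrix.of_apply, Matrix.of_apply, Quaternion.star_smul, star_mat_apply,
      hessForm_symm_coeff])
  have hZ : ∀ k l, Z.1.mat k l = ((a k - a l) / (d l - d k) - μ) • Y.mat k l := by
    intro k l
    rw [offDiagOf_mat, Matrix.of_apply]
    split_ifs with hkl
    · rw [hkl, hY l, smul_zero]
    · rfl
  have h1 := h Z.1 Z.2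
  rw [hessForm_apply, inner_eq_sum, ← sub_eq_zero, Finset.mul_sum, ← Finset.sum_sub_distrib] at h1
  have h2 : ∑ k, ∑ l, (((a k - a l) / (d l - d k) - μ) * ‖Y.mat k l‖) ^ 2 = 0 := by
    rw [← h1]
    refine Finset.sum_congr rfl fun k _ => ?_
    rw [Finset.mul_sum, ← Finset.sum_sub_distrib]
    refine Finset.sum_congr rfl fun l _ => ?_
    rw [hZ, real_inner_smul_right, real_inner_self_eq_norm_sq]
    ring
  have h3 := (Finset.sum_eq_zero_iff_of_nonneg fun k _ => Finset.sum_nonneg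
    fun l _ => sq_nonneg _).1 h2 i (Finset.mem_univ i)
  have h4 := (Finset.sum_eq_zero_iff_of_nonneg fun l _ => sq_nonneg _).1 h3 j (Finset.mem_univ j)
  have h5 := (mul_eq_zero.1 (pow_eq_zero_iff two_ne_zero |>.1 h4)).resolve_right
    (norm_ne_zero_iff.2 hij)
  linarith

theorem hessForm_eq_of_mem_pairSub (a d : Fin n → ℝ) {p q : Fin n} {Y : QHerm n}
    (hY : Y ∈ pairSub p q) (Z : QHerm n) :
    hessForm a d Y Z = (a p - a q) / (d q - d p) * inner ℝ Y Z := by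
  rw [hessForm_apply, inner_eq_sum, Finset.mul_sum]
  refine Finset.sum_congr rfl fun i _ => ?_
  rw [Finset.mul_sum]
  refine Finset.sum_congr rfl fun j _ => ?_
  by_cases h : (i = p ∧ j = q) ∨ (i = q ∧ j = p)
  · rcases h with ⟨rfl, rfl⟩ | ⟨rfl, rfl⟩
    · rfl
    · rw [hessForm_symm_coeff]
  · rw [hY i j h, inner_zero_left, mul_zero, mul_zero]

theorem hessForm_comm (a d : Fin n → ℝ) (Y Z : QHerm n) : hessForm a d Y Z = hessForm a d Z Y := by
  rw [hessForm_apply, hessForm_apply]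
  exact Finset.sum_congr rfl fun i _ => Finset.sum_congr rfl fun j _ => by
    rw [real_inner_comm]

theorem nondegenerate_hessForm {a d : Fin n → ℝ} (hai : Function.Injective a)
    (hdi : Function.Injective d) {T : Submodule ℝ (QHerm n)} (hT : T = offDiagSub n) :
    ((hessForm a d).restrict T).Nondegenerate := by
  subst hT
  have key : ∀ Y ∈ offDiagSub n, (∀ Z ∈ offDiagSub n, hessForm a d Y Z = 0) → Y = 0 := by
    intro Y hY h
    apply QHerm.ext_mat
    ext1 i j
    rw [mat_zero, Matrix.zero_apply]
    by_contra hij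
    have h1 := eq_of_hessForm_eq (μ := 0) hY (fun Z hZ => by rw [h Z hZ, zero_mul]) hij
    have hne : i ≠ j := by
      rintro rfl
      exact hij (hY i)
    rcases div_eq_zero_iff.1 h1 with h2 | h2
    · exact hne (hai (sub_eq_zero.1 h2))
    · exact hne (hdi (sub_eq_zero.1 h2)).symm
  refine ⟨fun Y h => Subtype.ext (key Y Y.2 fun Z hZ => h ⟨Z, hZ⟩), fun Y h =>
    Subtype.ext (key Y Y.2 fun Z hZ => ?_)⟩
  rw [hessForm_comm]
  exact h ⟨Z, hZ⟩

theorem mem_iSup_pairSub {I : Set (Fin n × Fin n)} {Y : QHerm n} (hY : Y ∈ offDiagSub n)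
    (h : ∀ i j, i < j → Y.mat i j ≠ 0 → (i, j) ∈ I) :
    Y ∈ ⨆ i : I, pairSub i.1.1 i.1.2 := by
  let part : Fin n × Fin n → QHerm n := fun x => (offDiagOf (Matrix.of fun i j =>
    if (i = x.1 ∧ j = x.2) ∨ (i = x.2 ∧ j = x.1) then Y.mat i j else 0) (by
      intro i j _
      rw [Matrix.of_apply, Matrix.of_apply, apply_ite star, star_mat_apply, star_zero]
      congr 1
      exact propext (by tauto))).1
  have hpart : ∀ x i j, (part x).mat i j
      = if (i = x.1 ∧ j = x.2) ∨ (i = x.2 ∧ j = x.1) then Y.mat i j else 0 := by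
    intro x i j
    rw [offDiagOf_mat, Matrix.of_apply]
    split_ifs with h1 h2 h2
    · rw [h1, hY j]
    · rfl
    · rfl
    · rfl
  -- The restriction to `x.1 < x.2` counts each off-diagonal position exactly once.
  have hsum : Y = ∑ x : Fin n × Fin n, if x.1 < x.2 then part x else 0 := by
    apply QHerm.ext_mat
    rw [← matL_apply (∑ x : Fin n × Fin n, if x.1 < x.2 then part x else 0), map_sum]
    ext1 i j
    rw [Matrix.sum_apply]
    simp only [matL_apply]
    rcases lt_trichotomy i j with hij | hij | hij
    · rw [Finset.sum_eq_single (i, j)]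
      · rw [if_pos hij, hpart]
        simp
      · rintro ⟨k, l⟩ _ hne
        split_ifs with hkl
        · rw [hpart, if_neg]
          rintro (⟨rfl, rfl⟩ | ⟨rfl, rfl⟩)
          · exact hne rfl
          · exact absurd hkl hij.not_gt
        · simp
      · simp
    · subst hij
      rw [hY i, Finset.sum_eq_zero]
      intro x _
      split_ifs
      · rw [hpart, hY i, ite_self]
      · simp
    · rw [Finset.sum_eq_single (j, i)]
      · rw [if_pos hij, hpart]
        simp
      · rintro ⟨k, l⟩ _ hne
        split_ifs with hkl
        · rw [hpart, if_neg]
          rintro (⟨rfl, rfl⟩ | ⟨rfl, rfl⟩)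
          · exact absurd hkl hij.not_gt
          · exact hne rfl
        · simp
      · simp
  rw [hsum]
  refine Submodule.sum_mem _ fun x _ => ?_
  split_ifs with hx
  · by_cases h0 : Y.mat x.1 x.2 = 0
    · have : part x = 0 := by
        apply QHerm.ext_mat
        ext1 i j
        rw [hpart, mat_zero, Matrix.zero_apply]
        split_ifs with h1
        · rcases h1 with ⟨rfl, rfl⟩ | ⟨rfl, rfl⟩
          · exact h0
          · rw [← star_mat_apply, h0, star_zero]
        · rfl
      rw [this]
      exact Submodule.zero_mem _
    · refine Submodule.mem_iSup_of_mem (⟨x, h x.1 x.2 hx h0⟩ : I) fun i j hij => ?_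
      rw [hpart, if_neg hij]
  · exact Submodule.zero_mem _

/-- An eigenvector for `μ < 0` has nonzero entries only at pairs with eigenvalue `μ`; conversely
each `pairSub` consists of eigenvectors. Different pairs may share an eigenvalue, so the eigenspaces
themselves need not be single summands. -/
theorem negativeSpace_hessForm {a d : Fin n → ℝ} {I : Set (Fin n × Fin n)}
    (hI : ∀ i j, (i, j) ∈ I ↔ i < j ∧ (a i - a j) / (d j - d i) < 0)
    {T : Submodule ℝ (QHerm n)} (hT : T = offDiagSub n) :
    negativeSpace ((hessForm a d).restrict T) = ⨆ i : I, pairSub i.1.1 i.1.2 := by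
  subst hT
  apply le_antisymm
  · refine Submodule.map_le_iff_le_comap.2 (iSup_le ?_)
    rintro ⟨μ, hμ⟩ Y hY
    refine mem_iSup_pairSub Y.2 fun i j hij h0 => (hI i j).2 ⟨hij, ?_⟩
    rw [eq_of_hessForm_eq Y.2 (fun Z hZ => hY ⟨Z, hZ⟩) h0]
    exact hμ
  · refine iSup_le ?_
    rintro ⟨⟨p, q⟩, hi⟩ Y hY
    obtain ⟨hpq, hneg⟩ := (hI p q).1 hi
    refine ⟨⟨Y, pairSub_le_offDiagSub hpq.ne hY⟩, ?_, rfl⟩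
    exact Submodule.mem_iSup_of_mem (⟨_, hneg⟩ : Set.Iio (0 : ℝ)) fun Z =>
      hessForm_eq_of_mem_pairSub a d hY Z

end QFlag
end

/-! ### Transfer to the points given by permutations, and the main theorem. -/

namespace QFlag

variable {n : ℕ}

/-- The type of the form depends on the manifold through its tangent space, so all properties are
bundled under one existential and the change of base point is made once, while the form is still
bound. -/
theorem exists_isHessianAt_permPoint {r a : Fin n → ℝ} (hri : Function.Injective r)
    (hr : ∑ i, r i = 0) (hai : Function.Injective a) (ha : ∑ i, a i = 0)
    (w : Equiv.Perm (Fin n)) :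
    ∃ B : LinearMap.BilinForm ℝ (tangentSpaceOf (flagManifold r hr) (permPoint r hr w)),
      IsHessianAt (flagManifold r hr) (height a ha) (permPoint r hr w) B ∧ B.Nondegenerate ∧
      ∀ I : Set (Fin n × Fin n),
        (∀ i j, (i, j) ∈ I ↔ i < j ∧ (a i - a j) / (r (w j) - r (w i)) < 0) →
        negativeSpace B = ⨆ i : I, pairSub i.1.1 i.1.2 := by
  have hdi : Function.Injective fun i => r (w i) := hri.comp w.injective
  have hd := comp_perm_sum hr w
  rw [flagManifold_eq_orbit r hr w]
  exact ⟨_, isHessianAt_hessForm hdi hd a ha,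
    nondegenerate_hessForm hai hdi (tangentSpaceOf_orbit hdi hd),
    fun I hI => negativeSpace_hessForm hI (tangentSpaceOf_orbit hdi hd)⟩

theorem permPoint_mul_swap (r : Fin n → ℝ) (hr : ∑ i, r i = 0) (w : Equiv.Perm (Fin n))
    {p q : Fin n} (hpq : p ≠ q) :
    permPoint r hr (w * Equiv.swap p q)
      = permPoint r hr w - poleVec hpq (fun i => r (w i)) - poleVec hpq fun i => r (w i) :=
  swap_eq_center_sub hpq (fun i => r (w i)) (comp_perm_sum hr w)
    (comp_perm_sum hr (w * Equiv.swap p q))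

/-- For `i < j` the height difference is `(a i - a j)(r (w i) - r (w j))`, of opposite sign to the
Hessian eigenvalue on the pair, so descents are exactly the negative directions. -/
theorem mem_descentPairs {r a : Fin n → ℝ} (hr : ∑ i, r i = 0) (haS : StrictMono a)
    (ha : ∑ i, a i = 0) (w : Equiv.Perm (Fin n)) (i j : Fin n) :
    (i, j) ∈ descentPairs r hr a ha w ↔ i < j ∧ (a i - a j) / (r (w j) - r (w i)) < 0 := by
  refine and_congr_right fun hij => ?_
  change i < j at hij
  change height a ha (permPoint r hr w) > height a ha (permPoint r hr (w * Equiv.swap i j)) ↔ _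
  rw [gt_iff_lt, ← sub_pos, height_permPoint_sub hr ha w hij.ne]
  have h := haS hij
  have h' : a i - a j < 0 := by linarith
  constructor
  · intro hpos
    exact div_neg_of_neg_of_pos h' (by linarith [neg_of_mul_pos_right hpos h'.le])
  · intro hneg
    refine mul_pos_of_neg_of_neg h' ?_
    by_contra hle
    exact absurd hneg (not_lt.2 (div_nonneg_of_nonpos h'.le (by linarith)))

end QFlag

theorem proposition2p1 (n : ℕ) (r a : Fin n → ℝ) (hr : StrictMono r) (hr0 : ∑ i, r i = 0)
    (ha : StrictMono a) (ha0 : ∑ i, a i = 0) :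
    -- the orbit is a smooth submanifold, so that the notions below make sense
    IsSmoothSubmanifold (2 * n * (n - 1)) (flagManifold r hr0) ∧
    -- (i) the critical set is the symmetric group, and all critical points are non-degenerate
    (Function.Injective (permPoint r hr0) ∧
      critSet (flagManifold r hr0) (height a ha0) = Set.range (permPoint r hr0) ∧
      (∀ (w : Equiv.Perm (Fin n)) (i : Fin n),
        flagLine r (permPoint r hr0 w) (w i) = Submodule.span ℍ[ℝ] {Pi.single i 1}) ∧
      ∀ x ∈ critSet (flagManifold r hr0) (height a ha0),
        ∃ B : LinearMap.BilinForm ℝ (tangentSpaceOf (flagManifold r hr0) x),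
          IsHessianAt (flagManifold r hr0) (height a ha0) x B ∧ B.Nondegenerate) ∧
    -- (ii) the orbits of `K_{pq}` are round four-spheres, and their meridians are gradient lines
    (∀ (w : Equiv.Perm (Fin n)) (p q : Fin n), p < q →
      height a ha0 (permPoint r hr0 w) >
        height a ha0 (permPoint r hr0 (w * Equiv.swap p q)) →
      ∃ (c : QHerm n) (E : Submodule ℝ (QHerm n)) (R : ℝ),
        Module.finrank ℝ E = 5 ∧ 0 < R ∧
        orbitSphere r hr0 w p q = roundSphere c E R ∧
        -- `w` and `w s_{pq}` are antipodal, and are the highest and the lowest point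
        permPoint r hr0 w ∈ roundSphere c E R ∧
        permPoint r hr0 (w * Equiv.swap p q) - c = -(permPoint r hr0 w - c) ∧
        (∀ x ∈ roundSphere c E R, x ≠ permPoint r hr0 w →
          height a ha0 x < height a ha0 (permPoint r hr0 w)) ∧
        (∀ x ∈ roundSphere c E R, x ≠ permPoint r hr0 (w * Equiv.swap p q) →
          height a ha0 (permPoint r hr0 (w * Equiv.swap p q)) < height a ha0 x) ∧
        ∀ u ∈ E, ‖u‖ = R → inner ℝ u (permPoint r hr0 w - c) = 0 →
          IsGradientLine (flagManifold r hr0) (height a ha0)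
            (meridian c (permPoint r hr0 w) u)
            (permPoint r hr0 (w * Equiv.swap p q)) (permPoint r hr0 w)) ∧
    -- (iii) the negative space of the Hessian is the direct sum of the tangent spaces of spheres
    ∀ w : Equiv.Perm (Fin n),
      ∃ B : LinearMap.BilinForm ℝ (tangentSpaceOf (flagManifold r hr0) (permPoint r hr0 w)),
        IsHessianAt (flagManifold r hr0) (height a ha0) (permPoint r hr0 w) B ∧
        iSupIndep (fun i : descentPairs r hr0 a ha0 w =>
          tangentSpaceOf (orbitSphere r hr0 w i.1.1 i.1.2) (permPoint r hr0 w)) ∧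
        negativeSpace B = ⨆ i : descentPairs r hr0 a ha0 w,
          tangentSpaceOf (orbitSphere r hr0 w i.1.1 i.1.2) (permPoint r hr0 w) := by
  have hri := hr.injective
  have hai := ha.injective
  refine ⟨isSmoothSubmanifold_flagManifold hri hr0, ⟨permPoint_injective hri hr0, ?_,
    flagLine_permPoint hri hr0, ?_⟩, ?_, ?_⟩
  · apply Set.Subset.antisymm
    · exact fun X hX => exists_perm_of_mem_critSet hri hr0 hai ha0 hX
    · rintro _ ⟨w, rfl⟩
      exact permPoint_mem_critSet hri hr0 ha0 w
  · intro x hx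
    obtain ⟨w, rfl⟩ := exists_perm_of_mem_critSet hri hr0 hai ha0 hx
    obtain ⟨B, h1, h2, -⟩ := exists_isHessianAt_permPoint hri hr0 hai ha0 w
    exact ⟨B, h1, h2⟩
  · intro w p q hpq hh
    have hd := comp_perm_sum hr0 w
    have hdi : Function.Injective fun i => r (w i) := hri.comp w.injective
    have hpos : 0 < (a p - a q) * (r (w p) - r (w q)) := by
      rw [← height_permPoint_sub hr0 ha0 w hpq.ne]
      exact sub_pos.2 hh
    have hdpq : r (w p) ≠ r (w q) := fun h => hpq.ne (hdi h)
    have hne : poleVec hpq.ne (fun i => r (w i)) ≠ 0 := poleVec_ne_zero hpq.ne hdpq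
    refine ⟨permPoint r hr0 w - poleVec hpq.ne fun i => r (w i), blockSub p q,
      ‖poleVec hpq.ne fun i => r (w i)‖, finrank_blockSub hpq.ne, norm_pos_iff.2 hne,
      orbit_Kpq_eq_roundSphere hpq.ne hd hdpq, ?_, ?_, ?_, ?_, ?_⟩
    · refine ⟨?_, ?_⟩
      · rw [sub_sub_cancel]
        exact poleVec_mem hpq.ne _
      · rw [sub_sub_cancel]
    · rw [permPoint_mul_swap r hr0 w hpq.ne]
      abel
    · exact fun x hx => (height_lt_of_mem_sphere hpq.ne hd a ha0 hpos hx).1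
    · rw [permPoint_mul_swap r hr0 w hpq.ne]
      exact fun x hx => (height_lt_of_mem_sphere hpq.ne hd a ha0 hpos hx).2
    · intro u hu hun huN
      rw [sub_sub_cancel] at huN
      rw [permPoint_mul_swap r hr0 w hpq.ne, flagManifold_eq_orbit r hr0 w]
      exact isGradientLine_meridian hpq.ne hdi hd a ha0 hpos hu hun huN
  · intro w
    have hd := comp_perm_sum hr0 w
    have hdi : Function.Injective fun i => r (w i) := hri.comp w.injective
    obtain ⟨B, h1, -, h2⟩ := exists_isHessianAt_permPoint hri hr0 hai ha0 w
    -- The tangent spaces of the spheres are the pair spaces, for which independence and the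
    -- negative space are already known.
    have htan : (fun i : descentPairs r hr0 a ha0 w =>
        tangentSpaceOf (orbitSphere r hr0 w i.1.1 i.1.2) (permPoint r hr0 w))
        = fun i => pairSub i.1.1 i.1.2 := by
      funext i
      exact tangentSpaceOf_orbit_Kpq i.2.1.ne hd fun h => i.2.1.ne (hdi h)
    refine ⟨B, h1, ?_, ?_⟩
    · rw [htan]
      exact iSupIndep_pairSub _ fun i hi => hi.1
    · rw [h2 _ (mem_descentPairs hr0 ha ha0 w)]
      exact (congrArg iSup htan).symm
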